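/- Let $n\ge 1$ and $n<p<\infty$. Let $$\mathcal D^{1,p}(\mathbb R^n)=\{u\in L^1_{\mathrm{loc}}(\mathbb R^n): u_{x_i}\in L^p(\mathbb R^n),\ i=1,\dots,n\}$$ (weak derivatives), where each $u$ is identified with its continuous representative, and put $\|Du\|_p=\left(\int_{\mathbb R^n}|Du|^p\,dx\right)^{1/p}$. Let $\rho$ be a signed Borel measure on $\mathbb R^n$ with compact support such that $\rho(\mathbb R^n)=0$ and $\int_{\mathbb R^n}y\,d\rho(y)\neq 0$. For $u\in\mathcal D^{1,p}(\mathbb R^n)$ set $$[u]_\rho=\sup_{S}\frac{\left|\int_{\mathbb R^n}u\,d(S_\#\rho)\right|}{\left|\int_{\mathbb R^n}x\,d(S_\#\rho)(x)\right|^{1-n/p}},$$ where $S$ ranges over all maps $S(y)=\lambda Oy+z$ with $\lambda>0$, $O\in \mathrm O(n)$, $z\in\mathbb R^n$, and $S_\#\rho$ is the push-forward of $\rho$ by $S$. Then there is a smallest constant $C_*\in[0,\infty)$ for which $$[u]_\rho\le C_*\|Du\|_p\qquad\text{for all }u\in\mathcal D^{1,p}(\mathbb R^n),$$ and there is a nonconstant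 $u\in\mathcal D^{1,p}(\mathbb R^n)$ with $[u]_\rho=C_*\|Du\|_p$. -/

import Mathlib

open MeasureTheory
open scoped ENNReal NNReal ContDiff

noncomputable section

namespace GeneralizedMorrey

/-- `g` is a weak gradient of `u` on `ℝⁿ`: both are locally integrable, and for every `i` the
`i`-th component of `g` is the weak partial derivative of `u` in the `i`-th coordinate direction,
tested against compactly supported smooth functions. -/
def HasWeakGradient {n : ℕ} (u : EuclideanSpace ℝ (Fin n) → ℝ)
    (g : EuclideanSpace ℝ (Fin n) → EuclideanSpace ℝ (Fin n)) : Prop :=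
  LocallyIntegrable u ∧ LocallyIntegrable g ∧
    ∀ φ : EuclideanSpace ℝ (Fin n) → ℝ, ContDiff ℝ ∞ φ → HasCompactSupport φ →
      ∀ i : Fin n,
        ∫ x, u x * fderiv ℝ φ x (EuclideanSpace.single i 1) = -∫ x, g x i * φ x

open Classical in
/-- The weak gradient `Du` (unique up to null sets when it exists; `0` if there is none). -/
def weakGradient {n : ℕ} (u : EuclideanSpace ℝ (Fin n) → ℝ) :
    EuclideanSpace ℝ (Fin n) → EuclideanSpace ℝ (Fin n) :=
  if h : ∃ g, HasWeakGradient u g then h.choose else 0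

/-- `‖Du‖_p = (∫ |Du|^p dx)^(1/p)`, with `|·|` the Euclidean norm on `ℝⁿ`. -/
def gradNorm {n : ℕ} (p : ℝ) (u : EuclideanSpace ℝ (Fin n) → ℝ) : ℝ≥0∞ :=
  eLpNorm (weakGradient u) (ENNReal.ofReal p) volume

/-- The homogeneous Sobolev space `𝒟^{1,p}(ℝⁿ)` for `p > n`: locally integrable functions whose
weak partial derivatives are in `L^p`. As usual for `p > n`, each class is identified with its
(unique) continuous representative, so the elements are continuous functions. -/
def D1p (n : ℕ) (p : ℝ) : Set (EuclideanSpace ℝ (Fin n) → ℝ) :=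
  {u | Continuous u ∧ ∃ g, HasWeakGradient u g ∧ MemLp g (ENNReal.ofReal p) volume}

/-- The similarity transformations `S(y) = λ O y + z` of `ℝⁿ`, with `λ > 0`, `O ∈ O(n)` and
`z ∈ ℝⁿ`. -/
def similarities (n : ℕ) : Set (EuclideanSpace ℝ (Fin n) → EuclideanSpace ℝ (Fin n)) :=
  {S | ∃ (r : ℝ) (O : EuclideanSpace ℝ (Fin n) ≃ₗᵢ[ℝ] EuclideanSpace ℝ (Fin n))
      (z : EuclideanSpace ℝ (Fin n)), 0 < r ∧ S = fun y => r • O y + z}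

/-- The support of a signed measure: the support of its total variation. -/
def signedSupport {n : ℕ} (ρ : SignedMeasure (EuclideanSpace ℝ (Fin n))) :
    Set (EuclideanSpace ℝ (Fin n)) :=
  ρ.totalVariation.support

/-- The quotient `|∫ u dμ| / |∫ x dμ(x)|^(1 - n/p)`. -/
def morreyQuotient {n : ℕ} (p : ℝ) (μ : SignedMeasure (EuclideanSpace ℝ (Fin n)))
    (u : EuclideanSpace ℝ (Fin n) → ℝ) : ℝ :=
  |∫ᵛ x, u x ∂•μ| / ‖∫ᵛ x, x ∂<•μ‖ ^ (1 - (n : ℝ) / p)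

/-- The seminorm `[u]_ρ`: the supremum, a priori in `[0, ∞]`, of the quotients
`|∫ u dμ| / |∫ x dμ(x)|^(1 - n/p)` over all push forwards `μ` of `ρ` by similarities. -/
def rhoSeminorm {n : ℕ} (p : ℝ) (ρ : SignedMeasure (EuclideanSpace ℝ (Fin n)))
    (u : EuclideanSpace ℝ (Fin n) → ℝ) : ℝ≥0∞ :=
  ⨆ S ∈ similarities n, ENNReal.ofReal (morreyQuotient p (ρ.map S) u)

/-- `C` is a constant for which the generalized Morrey inequality `[u]_ρ ≤ C ‖Du‖_p` holds for
all `u ∈ 𝒟^{1,p}(ℝⁿ)`. -/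
def IsMorreyConstant {n : ℕ} (p : ℝ) (ρ : SignedMeasure (EuclideanSpace ℝ (Fin n)))
    (C : ℝ≥0) : Prop :=
  ∀ u ∈ D1p n p, rhoSeminorm p ρ u ≤ C * gradNorm p u

end GeneralizedMorrey

end

noncomputable section

namespace GeneralizedMorrey

open Filter Topology Metric

/-! ### Uniform convexity of `L^p` and attainment of norms -/

section UniformConvexity

variable {F : Type*} [NormedAddCommGroup F] [NormedSpace ℝ F]

/-! Write m for the first moment of `ρ`. Since `ρ` has total mass zero, S(y) = rOy + z pushes the
moment to rOm, while ‖D(u ∘ S)‖_p = r^(1 - n/p) ‖Du‖_p. The exponent in the quotient is chosen so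
that these powers of r cancel. Everything therefore reduces to the single linear functional u ↦ ∫ u
dρ: if K is its norm with respect to ‖Du‖_p, the sharp constant is K / |m|^(1 - n/p).

It remains to see that K is finite and attained. Morrey's inequality
(`HasWeakGradient.abs_sub_integral_le`) bounds u minus a fixed average on bounded sets by ‖Du‖_p;
neutrality of `ρ` removes the average, so the functional is bounded
(`exists_forall_abs_integral_le`). The same estimate shows that the gradient fields form a closed
subspace of `L^p` (`isClosed_gradientSubmodule`). This subspace is complete and uniformly convex, so
the functional attains its norm there (`exists_norm_le_one_apply_eq_norm`). Finally K > 0, because a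
cut-off of the linear function ⟨m, x⟩ pairs to |m|² > 0, and hence the maximizer is not constant. -/

theorem norm_midpoint_rpow_lt [StrictConvexSpace ℝ F] {p : ℝ} (hp : 1 < p) {a b : F}
    (hab : a ≠ b) :
    ‖(1 / 2 : ℝ) • (a + b)‖ ^ p < (‖a‖ ^ p + ‖b‖ ^ p) / 2 := by
  have hp0 : 0 < p := by linarith
  -- Vectors of equal norm need strict convexity of the space; for different norms, strict convexity
  -- of t ↦ t^p suffices.
  by_cases h : ‖a‖ = ‖b‖
  · have h1 := Real.rpow_lt_rpow (norm_nonneg _) ((norm_midpoint_lt_iff h).2 hab) hp0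
    rw [← h]
    linarith
  · have h1 : ‖(1 / 2 : ℝ) • (a + b)‖ ≤ (1 / 2) * ‖a‖ + (1 / 2) * ‖b‖ := by
      rw [norm_smul, ← mul_add]
      norm_num
      exact norm_add_le a b
    have h2 := (strictConvexOn_rpow hp).2 (norm_nonneg a) (norm_nonneg b) h
      (by norm_num : (0 : ℝ) < 1 / 2) (by norm_num : (0 : ℝ) < 1 / 2) (by norm_num)
    simp only [smul_eq_mul] at h2
    have h3 := Real.rpow_le_rpow (norm_nonneg _) h1 hp0.le
    linarith

theorem norm_midpoint_rpow_le [StrictConvexSpace ℝ F] {p : ℝ} (hp : 1 < p) (a b : F) :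
    ‖(1 / 2 : ℝ) • (a + b)‖ ^ p ≤ (‖a‖ ^ p + ‖b‖ ^ p) / 2 := by
  rcases eq_or_ne a b with rfl | h
  · rw [← two_smul ℝ a, smul_smul]
    norm_num
  · exact (norm_midpoint_rpow_lt hp h).le

/-- A quantitative form of the strict convexity of `‖·‖ ^ p`: the distance of two vectors is
controlled by the defect in the midpoint convexity inequality. -/
theorem exists_norm_sub_rpow_le [FiniteDimensional ℝ F] [StrictConvexSpace ℝ F] {p : ℝ}
    (hp : 1 < p) {ε : ℝ} (hε : 0 < ε) :
    ∃ K : ℝ, 0 ≤ K ∧ ∀ a b : F, ‖a - b‖ ^ p ≤ ε * (‖a‖ ^ p + ‖b‖ ^ p) +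
      K * ((‖a‖ ^ p + ‖b‖ ^ p) / 2 - ‖(1 / 2 : ℝ) • (a + b)‖ ^ p) := by
  have hp0 : 0 < p := by linarith
  let d : F × F → ℝ := fun z =>
    (‖z.1‖ ^ p + ‖z.2‖ ^ p) / 2 - ‖(1 / 2 : ℝ) • (z.1 + z.2)‖ ^ p
  let e : F × F → ℝ := fun z => ‖z.1 - z.2‖ ^ p
  let s : F × F → ℝ := fun z => ε * (‖z.1‖ ^ p + ‖z.2‖ ^ p)
  have hrp : Continuous fun t : ℝ => t ^ p := Real.continuous_rpow_const hp0.le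
  have hd : Continuous d := by
    refine (Continuous.div_const ?_ 2).sub (hrp.comp (by fun_prop))
    exact (hrp.comp (by fun_prop)).add (hrp.comp (by fun_prop))
  have he : Continuous e := hrp.comp (by fun_prop)
  have hs : Continuous s :=
    continuous_const.mul ((hrp.comp (by fun_prop)).add (hrp.comp (by fun_prop)))
  have hd0 : ∀ z, 0 ≤ d z := fun z => sub_nonneg.2 (norm_midpoint_rpow_le hp _ _)
  have := FiniteDimensional.proper_real (F × F)
  have key : ∃ K : ℝ, 0 ≤ K ∧ ∀ z ∈ Metric.sphere (0 : F × F) 1, e z ≤ s z + K * d z := by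
    -- Only points with `s ≤ e` matter, and they form a compact set. There `d > 0`: `d = 0` would
    -- force equal components, so `e = 0`, then `s = 0` and `z = 0`, which is off the sphere. Hence
    -- K = max e / min d works.
    let T : Set (F × F) := Metric.sphere (0 : F × F) 1 ∩ {z | s z ≤ e z}
    have hT : IsCompact T := (isCompact_sphere _ _).inter_right (isClosed_le hs he)
    rcases T.eq_empty_or_nonempty with h | h
    · refine ⟨0, le_rfl, fun z hz => ?_⟩
      by_contra! hc
      have : z ∈ T := ⟨hz, by simpa using (show s z + 0 * d z ≤ e z from hc.le)⟩
      simp [h] at this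
    · obtain ⟨z₀, hz₀, hmin⟩ := hT.exists_isMinOn h hd.continuousOn
      obtain ⟨z₁, hz₁, hmax⟩ := hT.exists_isMaxOn h he.continuousOn
      have hpos : 0 < d z₀ := by
        refine sub_pos.2 (norm_midpoint_rpow_lt hp fun heq => ?_)
        have h1 : s z₀ ≤ e z₀ := hz₀.2
        simp only [s, e, heq, sub_self, norm_zero, Real.zero_rpow hp0.ne'] at h1
        have h2 : ‖z₀.2‖ ^ p = 0 := by
          have := Real.rpow_nonneg (norm_nonneg z₀.2) p
          nlinarith
        rw [Real.rpow_eq_zero (norm_nonneg _) hp0.ne'] at h2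
        have h3 : ‖z₀‖ = 1 := by simpa using hz₀.1
        rw [Prod.norm_def, heq, h2] at h3
        simp at h3
      refine ⟨e z₁ / d z₀, div_nonneg (Real.rpow_nonneg (norm_nonneg _) _) hpos.le,
        fun z hz => ?_⟩
      by_cases hz' : s z ≤ e z
      · have h1 : e z ≤ e z₁ := hmax ⟨hz, hz'⟩
        have h2 : d z₀ ≤ d z := hmin ⟨hz, hz'⟩
        have h3 : e z₁ ≤ e z₁ / d z₀ * d z := by
          rw [div_mul_eq_mul_div, le_div_iff₀ hpos]
          exact mul_le_mul_of_nonneg_left h2 (Real.rpow_nonneg (norm_nonneg _) _)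
        have h4 : 0 ≤ s z := by positivity
        linarith
      · have : 0 ≤ e z₁ / d z₀ * d z :=
          mul_nonneg (div_nonneg (Real.rpow_nonneg (norm_nonneg _) _) hpos.le) (hd0 z)
        linarith
  obtain ⟨K, hK, h⟩ := key
  refine ⟨K, hK, fun a b => ?_⟩
  rcases eq_or_ne (a, b) 0 with hab | hab
  · obtain ⟨rfl, rfl⟩ := Prod.mk_eq_zero.1 hab
    simp [Real.zero_rpow hp0.ne']
  -- All terms are homogeneous of degree p, so the bound on the sphere extends by scaling.
  set t := ‖(a, b)‖ with ht
  have htpos : 0 < t := norm_pos_iff.2 hab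
  have hz := h (t⁻¹ • (a, b)) (by
    rw [mem_sphere_zero_iff_norm, norm_smul, norm_inv, norm_norm, inv_mul_cancel₀ htpos.ne'])
  have hsm : ∀ v : F, ‖t⁻¹ • v‖ ^ p = (t⁻¹) ^ p * ‖v‖ ^ p := fun v => by
    rw [norm_smul, Real.norm_of_nonneg (inv_nonneg.2 htpos.le),
      Real.mul_rpow (inv_nonneg.2 htpos.le) (norm_nonneg _)]
  simp only [e, s, d, Prod.smul_mk, ← smul_sub, ← smul_add] at hz
  rw [smul_comm (1 / 2 : ℝ) (t⁻¹)] at hz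
  simp only [hsm] at hz
  have hc : 0 < (t⁻¹) ^ p := Real.rpow_pos_of_pos (inv_pos.2 htpos) _
  refine le_of_mul_le_mul_left ?_ hc
  linarith

variable {X : Type*} [MeasurableSpace X] {μ : Measure X}

theorem Lp_norm_rpow_eq_integral {G : Type*} [NormedAddCommGroup G] {p : ℝ}
    (hp : 0 < p) (f : Lp G (ENNReal.ofReal p) μ) :
    ‖f‖ ^ p = ∫ x, ‖f x‖ ^ p ∂μ := by
  have h0 : ENNReal.ofReal p ≠ 0 := by simpa using hp
  rw [Lp.norm_def, (Lp.memLp f).eLpNorm_eq_integral_rpow_norm h0 ENNReal.ofReal_ne_top,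
    ENNReal.toReal_ofReal hp.le, ENNReal.toReal_ofReal, ← Real.rpow_mul, inv_mul_cancel₀ hp.ne',
    Real.rpow_one]
  all_goals positivity

theorem integrable_Lp_norm_rpow {G : Type*} [NormedAddCommGroup G] {p : ℝ}
    (hp : 0 < p) (f : Lp G (ENNReal.ofReal p) μ) :
    Integrable (fun x => ‖f x‖ ^ p) μ := by
  have := (Lp.memLp f).integrable_norm_rpow (by simpa using hp) ENNReal.ofReal_ne_top
  rwa [ENNReal.toReal_ofReal hp.le] at this

/-- **Clarkson's theorem**: `L^p` is uniformly convex for `1 < p < ∞`. -/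
theorem uniformConvexSpace_Lp [FiniteDimensional ℝ F] [StrictConvexSpace ℝ F] {p : ℝ}
    (hp : 1 < p) [Fact (1 ≤ ENNReal.ofReal p)] :
    UniformConvexSpace (Lp F (ENNReal.ofReal p) μ) := by
  have hp0 : 0 < p := by linarith
  refine ⟨fun ε hε => ?_⟩
  have hεp : 0 < ε ^ p := Real.rpow_pos_of_pos hε _
  -- For unit vectors the first term integrates to ε^p / 2, and δ is chosen to make the defect term
  -- smaller than ε^p / 2, contradicting ε ≤ ‖f - g‖.
  obtain ⟨K, hK, h⟩ := exists_norm_sub_rpow_le (F := F) hp (ε := ε ^ p / 4) (by positivity)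
  have hlim : Tendsto (fun δ : ℝ => K * (1 - (1 - δ / 2) ^ p)) (𝓝[>] 0) (𝓝 0) := by
    have hc : Continuous fun δ : ℝ => K * (1 - (1 - δ / 2) ^ p) :=
      continuous_const.mul (continuous_const.sub
        ((Real.continuous_rpow_const hp0.le).comp (by fun_prop)))
    have := (hc.tendsto 0).mono_left (nhdsWithin_le_nhds (s := Set.Ioi 0))
    simpa using this
  have hlt : ∀ᶠ δ : ℝ in 𝓝[>] 0, δ < 1 := nhdsWithin_le_nhds (Iio_mem_nhds zero_lt_one)
  have hgt : ∀ᶠ δ : ℝ in 𝓝[>] 0, 0 < δ := self_mem_nhdsWithin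
  obtain ⟨δ, hδ, hδ1, hδ0⟩ := ((hlim.eventually_lt_const
    (show 0 < ε ^ p / 2 by positivity)).and (hlt.and hgt)).exists
  refine ⟨δ, hδ0, fun f hf g hg hfg => ?_⟩
  by_contra! hc
  have hhalf : ‖(1 / 2 : ℝ) • (f + g)‖ = ‖f + g‖ / 2 := by
    rw [norm_smul]; norm_num; ring
  have hlow : (1 - δ / 2) ^ p ≤ ‖(1 / 2 : ℝ) • (f + g)‖ ^ p := by
    rw [hhalf]
    have : δ < 1 := hδ1
    exact Real.rpow_le_rpow (by linarith) (by linarith) hp0.le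
  have hint : ‖f - g‖ ^ p ≤ ε ^ p / 4 * (‖f‖ ^ p + ‖g‖ ^ p) +
      K * ((‖f‖ ^ p + ‖g‖ ^ p) / 2 - ‖(1 / 2 : ℝ) • (f + g)‖ ^ p) := by
    have If := integrable_Lp_norm_rpow hp0 f
    have Ig := integrable_Lp_norm_rpow hp0 g
    have Im := integrable_Lp_norm_rpow hp0 ((1 / 2 : ℝ) • (f + g))
    have Is := integrable_Lp_norm_rpow hp0 (f - g)
    have If' : Integrable (fun x => ‖f x‖ ^ p + ‖g x‖ ^ p) μ := If.add Ig
    have Id : Integrable (fun x => K * ((‖f x‖ ^ p + ‖g x‖ ^ p) / 2 -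
        ‖((1 / 2 : ℝ) • (f + g) : Lp F (ENNReal.ofReal p) μ) x‖ ^ p)) μ :=
      ((If'.div_const 2).sub Im).const_mul K
    rw [Lp_norm_rpow_eq_integral hp0, Lp_norm_rpow_eq_integral hp0, Lp_norm_rpow_eq_integral hp0,
      Lp_norm_rpow_eq_integral hp0, ← integral_add If Ig, ← integral_const_mul,
      ← integral_div, ← integral_sub (If'.div_const 2) Im, ← integral_const_mul,
      ← integral_add (If'.const_mul _) Id]
    refine integral_mono_ae Is ((If'.const_mul _).add Id) ?_
    filter_upwards [Lp.coeFn_sub f g, Lp.coeFn_add f g, Lp.coeFn_smul (1 / 2 : ℝ) (f + g)]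
      with x h1 h2 h3
    simp only [h1, h3, h2, Pi.sub_apply, Pi.add_apply, Pi.smul_apply]
    exact h (f x) (g x)
  rw [hf, hg, Real.one_rpow] at hint
  have h1 := Real.rpow_le_rpow hε.le hfg hp0.le
  have h2 := mul_le_mul_of_nonneg_left hlow hK
  have h3 : K * (1 - (1 - δ / 2) ^ p) < ε ^ p / 2 := hδ
  linarith

/-- A submodule of a uniformly convex space is uniformly convex. -/
theorem uniformConvexSpace_submodule [UniformConvexSpace F] (W : Submodule ℝ F) :
    UniformConvexSpace W := by
  refine ⟨fun ε hε => ?_⟩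
  obtain ⟨δ, hδ, h⟩ := exists_forall_sphere_dist_add_le_two_sub F hε
  exact ⟨δ, hδ, fun x hx y hy hxy => h (x := x) hx (y := y) hy hxy⟩

/-- A bounded linear functional on a complete uniformly convex space attains its norm. -/
theorem exists_norm_le_one_apply_eq_norm [CompleteSpace F] [UniformConvexSpace F]
    (f : F →L[ℝ] ℝ) : ∃ x : F, ‖x‖ ≤ 1 ∧ f x = ‖f‖ := by
  rcases eq_or_ne f 0 with rfl | hf
  · exact ⟨0, by simp, by simp⟩
  have hf0 : 0 < ‖f‖ := norm_pos_iff.2 hf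
  have hex : ∀ k : ℕ, ∃ x : F, ‖x‖ ≤ 1 ∧ ‖f‖ * (1 - 1 / ((k : ℝ) + 1)) ≤ f x := by
    intro k
    have hk : (0 : ℝ) < 1 / ((k : ℝ) + 1) := by positivity
    obtain ⟨x, hx, hlt⟩ := f.exists_lt_apply_of_lt_opNorm
      (r := ‖f‖ * (1 - 1 / ((k : ℝ) + 1))) (by nlinarith)
    rcases le_total 0 (f x) with h0 | h0
    · exact ⟨x, hx.le, by rw [Real.norm_of_nonneg h0] at hlt; exact hlt.le⟩
    · exact ⟨-x, by simpa using hx.le, by rw [Real.norm_of_nonpos h0] at hlt; simpa using hlt.le⟩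
  choose x hx1 hx2 using hex
  -- If two almost maximizers were ε apart, their sum would have norm at most 2 - δ, too small for
  -- the value of f on it.
  have hcau : CauchySeq x := by
    rw [Metric.cauchySeq_iff]
    intro ε hε
    obtain ⟨δ, hδ, h⟩ := exists_forall_closed_ball_dist_add_le_two_sub F hε
    obtain ⟨N, hN⟩ := exists_nat_one_div_lt (half_pos hδ)
    refine ⟨N, fun k hk m hm => ?_⟩
    by_contra! hc
    rw [dist_eq_norm] at hc
    have h1 := h (hx1 k) (hx1 m) hc
    have h2 : f (x k + x m) ≤ ‖f‖ * ‖x k + x m‖ := (le_abs_self _).trans (f.le_opNorm _)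
    rw [map_add] at h2
    have h3 := hx2 k
    have h4 := hx2 m
    have h5 : (1 : ℝ) / ((k : ℝ) + 1) < δ / 2 :=
      (one_div_le_one_div_of_le (by positivity) (by gcongr)).trans_lt hN
    have h6 : (1 : ℝ) / ((m : ℝ) + 1) < δ / 2 :=
      (one_div_le_one_div_of_le (by positivity) (by gcongr)).trans_lt hN
    have h7 := mul_le_mul_of_nonneg_left h1 hf0.le
    nlinarith
  obtain ⟨y, hy⟩ := cauchySeq_tendsto_of_complete hcau
  refine ⟨y, le_of_tendsto hy.norm (Eventually.of_forall hx1), le_antisymm ?_ ?_⟩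
  · have hy1 : ‖y‖ ≤ 1 := le_of_tendsto hy.norm (Eventually.of_forall hx1)
    calc f y ≤ ‖f‖ * ‖y‖ := (le_abs_self _).trans (f.le_opNorm _)
      _ ≤ ‖f‖ := mul_le_of_le_one_right (norm_nonneg _) hy1
  · have hl : Tendsto (fun k : ℕ => ‖f‖ * (1 - 1 / ((k : ℝ) + 1))) atTop (𝓝 (‖f‖ * (1 - 0))) :=
      (tendsto_const_nhds.sub tendsto_one_div_add_atTop_nhds_zero_nat).const_mul _
    rw [sub_zero, mul_one] at hl
    exact le_of_tendsto_of_tendsto' hl ((f.continuous.tendsto y).comp hy) hx2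

end UniformConvexity

/-! ### Calculus of weak gradients -/

section WeakGradient

variable {n : ℕ} {u v : EuclideanSpace ℝ (Fin n) → ℝ}
  {g h : EuclideanSpace ℝ (Fin n) → EuclideanSpace ℝ (Fin n)}
  {φ : EuclideanSpace ℝ (Fin n) → ℝ}

theorem LocallyIntegrable.integrable_mul_of_hasCompactSupport
    (hu : LocallyIntegrable u) (hφ : Continuous φ) (hc : HasCompactSupport φ) :
    Integrable fun x => u x * φ x :=
  hu.integrable_smul_right_of_hasCompactSupport hφ hc

theorem locallyIntegrable_coord (hg : LocallyIntegrable g) (i : Fin n) :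
    LocallyIntegrable fun x => g x i := by
  rw [locallyIntegrable_iff] at hg ⊢
  exact fun K hK => (EuclideanSpace.proj (𝕜 := ℝ) i).integrable_comp (hg K hK)

theorem hasCompactSupport_fderiv_apply (hc : HasCompactSupport φ)
    (y : EuclideanSpace ℝ (Fin n)) : HasCompactSupport fun x => fderiv ℝ φ x y :=
  hc.fderiv_apply (𝕜 := ℝ) y

theorem continuous_fderiv_apply_const (hφ : ContDiff ℝ ∞ φ) (y : EuclideanSpace ℝ (Fin n)) :
    Continuous fun x => fderiv ℝ φ x y :=
  (hφ.continuous_fderiv (by simp)).clm_apply continuous_const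

theorem HasWeakGradient.add (hu : HasWeakGradient u g) (hv : HasWeakGradient v h) :
    HasWeakGradient (u + v) (g + h) := by
  refine ⟨hu.1.add hv.1, hu.2.1.add hv.2.1, fun φ hφ hc i => ?_⟩
  have hf := continuous_fderiv_apply_const hφ (EuclideanSpace.single i 1)
  have hfc := hasCompactSupport_fderiv_apply hc (EuclideanSpace.single i 1)
  simp only [Pi.add_apply, PiLp.add_apply, add_mul]
  rw [integral_add (LocallyIntegrable.integrable_mul_of_hasCompactSupport hu.1 hf hfc)
      (LocallyIntegrable.integrable_mul_of_hasCompactSupport hv.1 hf hfc),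
    integral_add (LocallyIntegrable.integrable_mul_of_hasCompactSupport
        (locallyIntegrable_coord hu.2.1 i) hφ.continuous hc)
      (LocallyIntegrable.integrable_mul_of_hasCompactSupport
        (locallyIntegrable_coord hv.2.1 i) hφ.continuous hc),
    hu.2.2 φ hφ hc i, hv.2.2 φ hφ hc i]
  ring

theorem HasWeakGradient.const_smul (hu : HasWeakGradient u g) (c : ℝ) :
    HasWeakGradient (c • u) (c • g) := by
  refine ⟨hu.1.smul c, hu.2.1.smul c, fun φ hφ hc i => ?_⟩
  simp only [Pi.smul_apply, PiLp.smul_apply, smul_eq_mul, mul_assoc]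
  rw [integral_const_mul, integral_const_mul, hu.2.2 φ hφ hc i]
  ring

theorem HasWeakGradient.congr_ae (hu : HasWeakGradient u g) (hgh : g =ᵐ[volume] h) :
    HasWeakGradient u h := by
  refine ⟨hu.1, hu.2.1.congr hgh, fun φ hφ hc i => ?_⟩
  rw [hu.2.2 φ hφ hc i]
  congr 1
  refine integral_congr_ae ?_
  filter_upwards [hgh] with x hx
  rw [hx]

/-- The fundamental lemma of the calculus of variations, applied to each component. -/
theorem HasWeakGradient.ae_eq (hg : HasWeakGradient u g) (hh : HasWeakGradient u h) :
    g =ᵐ[volume] h := by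
  have hi : ∀ i, ∀ᵐ x, g x i = h x i := fun i => by
    refine ae_eq_of_integral_contDiff_smul_eq (locallyIntegrable_coord hg.2.1 i)
      (locallyIntegrable_coord hh.2.1 i) fun φ hφ hc => ?_
    have := (hg.2.2 φ hφ hc i).symm.trans (hh.2.2 φ hφ hc i)
    simpa [mul_comm] using neg_injective this
  filter_upwards [ae_all_iff.2 hi] with x hx
  ext i
  exact hx i

/-- A continuously differentiable function has its gradient as weak gradient. -/
theorem hasWeakGradient_gradient (hu : ContDiff ℝ 1 u) : HasWeakGradient u (gradient u) := by
  have hgc : Continuous (gradient u) :=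
    (InnerProductSpace.toDual ℝ _).symm.continuous.comp (hu.continuous_fderiv (by simp))
  refine ⟨hu.continuous.locallyIntegrable, hgc.locallyIntegrable, fun φ hφ hc i => ?_⟩
  have hcoord : ∀ x, gradient u x i = fderiv ℝ u x (EuclideanSpace.single i 1) := fun x => by
    have h1 : inner ℝ (gradient u x) (EuclideanSpace.single i (1 : ℝ)) =
        fderiv ℝ u x (EuclideanSpace.single i 1) := by
      simp [gradient]
    rw [← h1, EuclideanSpace.inner_single_right]
    simp
  simp only [hcoord]
  have hu' : Continuous fun x => fderiv ℝ u x (EuclideanSpace.single i 1) :=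
    (hu.continuous_fderiv (by simp)).clm_apply continuous_const
  exact integral_mul_fderiv_eq_neg_fderiv_mul_of_integrable
    (LocallyIntegrable.integrable_mul_of_hasCompactSupport hu'.locallyIntegrable hφ.continuous hc)
    (LocallyIntegrable.integrable_mul_of_hasCompactSupport hu.continuous.locallyIntegrable
      (continuous_fderiv_apply_const hφ _) (hasCompactSupport_fderiv_apply hc _))
    (LocallyIntegrable.integrable_mul_of_hasCompactSupport hu.continuous.locallyIntegrable
      hφ.continuous hc)
    (fun x _ => (hu.differentiable (by simp)).differentiableAt)
    (fun x _ => (hφ.differentiable (by simp)).differentiableAt)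

theorem hasWeakGradient_const (c : ℝ) :
    HasWeakGradient (fun _ : EuclideanSpace ℝ (Fin n) => c) 0 := by
  have := hasWeakGradient_gradient (n := n) (u := fun _ => c) contDiff_const
  have h0 : gradient (fun _ : EuclideanSpace ℝ (Fin n) => c) = 0 := by
    ext1 x
    simp [gradient]
  rwa [h0] at this

theorem fderiv_eq_sum_coord (L : EuclideanSpace ℝ (Fin n) →L[ℝ] ℝ)
    (y : EuclideanSpace ℝ (Fin n)) : L y = ∑ i, y i * L (EuclideanSpace.single i 1) := by
  have h1 := (EuclideanSpace.basisFun (Fin n) ℝ).sum_repr y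
  conv_lhs => rw [← h1]
  simp [map_sum]

/-- The defining identity of the weak gradient in an arbitrary direction. -/
theorem HasWeakGradient.integral_mul_fderiv (hu : HasWeakGradient u g) (hφ : ContDiff ℝ ∞ φ)
    (hc : HasCompactSupport φ) (y : EuclideanSpace ℝ (Fin n)) :
    ∫ x, u x * fderiv ℝ φ x y = -∫ x, inner ℝ (g x) y * φ x := by
  have h1 : ∀ x, u x * fderiv ℝ φ x y =
      ∑ i, y i * (u x * fderiv ℝ φ x (EuclideanSpace.single i 1)) := fun x => by
    rw [fderiv_eq_sum_coord (fderiv ℝ φ x) y, Finset.mul_sum]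
    exact Finset.sum_congr rfl fun i _ => by ring
  have h2 : ∀ x, inner ℝ (g x) y * φ x = ∑ i, y i * (g x i * φ x) := fun x => by
    rw [PiLp.inner_apply, Finset.sum_mul]
    refine Finset.sum_congr rfl fun i _ => ?_
    simp [mul_assoc]
  simp only [h1, h2]
  rw [integral_finsetSum, integral_finsetSum, ← Finset.sum_neg_distrib]
  · refine Finset.sum_congr rfl fun i _ => ?_
    rw [integral_const_mul, integral_const_mul, hu.2.2 φ hφ hc i]
    ring
  · exact fun i _ => (LocallyIntegrable.integrable_mul_of_hasCompactSupport
      (locallyIntegrable_coord hu.2.1 i) hφ.continuous hc).const_mul _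
  · exact fun i _ => (LocallyIntegrable.integrable_mul_of_hasCompactSupport hu.1
      (continuous_fderiv_apply_const hφ _) (hasCompactSupport_fderiv_apply hc _)).const_mul _

/-- The weak gradient tested against the vector field `(w - x) φ(w)`. -/
theorem HasWeakGradient.integral_mul_div_radial (hu : HasWeakGradient u g)
    (hφ : ContDiff ℝ ∞ φ) (hc : HasCompactSupport φ) (x : EuclideanSpace ℝ (Fin n)) :
    ∫ w, u w * (n * φ w + fderiv ℝ φ w (w - x)) = -∫ w, inner ℝ (g w) (w - x) * φ w := by
  -- The divergence of the field with components `ψ i` is exactly nφ + Dφ(w)(w - x).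
  let ψ : Fin n → EuclideanSpace ℝ (Fin n) → ℝ := fun i w => (w i - x i) * φ w
  have hψ : ∀ i, ContDiff ℝ ∞ (ψ i) := fun i =>
    (((EuclideanSpace.proj (𝕜 := ℝ) i).contDiff).sub contDiff_const).mul hφ
  have hψc : ∀ i, HasCompactSupport (ψ i) := fun i => hc.mul_left
  have hd : ∀ i w, fderiv ℝ (ψ i) w (EuclideanSpace.single i 1) =
      φ w + (w i - x i) * fderiv ℝ φ w (EuclideanSpace.single i 1) := fun i w => by
    have ha : HasFDerivAt (fun w : EuclideanSpace ℝ (Fin n) => w i - x i)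
        (EuclideanSpace.proj (𝕜 := ℝ) i) w :=
      (EuclideanSpace.proj (𝕜 := ℝ) i).hasFDerivAt.sub_const _
    have hb := (hφ.differentiable (by simp)).differentiableAt (x := w).hasFDerivAt
    have hm : HasFDerivAt (ψ i) _ w := ha.mul hb
    rw [hm.fderiv]
    simp
    ring
  have h1 : ∀ w, u w * (n * φ w + fderiv ℝ φ w (w - x)) =
      ∑ i, u w * fderiv ℝ (ψ i) w (EuclideanSpace.single i 1) := fun w => by
    rw [fderiv_eq_sum_coord (fderiv ℝ φ w) (w - x), ← Finset.mul_sum]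
    simp only [hd, Finset.sum_add_distrib]
    simp
  have h2 : ∀ w, inner ℝ (g w) (w - x) * φ w = ∑ i, g w i * ψ i w := fun w => by
    rw [PiLp.inner_apply, Finset.sum_mul]
    refine Finset.sum_congr rfl fun i _ => ?_
    simp [ψ]
    ring
  simp only [h1, h2]
  rw [integral_finsetSum, integral_finsetSum, ← Finset.sum_neg_distrib]
  · exact Finset.sum_congr rfl fun i _ => hu.2.2 (ψ i) (hψ i) (hψc i) i
  · exact fun i _ => LocallyIntegrable.integrable_mul_of_hasCompactSupport
      (locallyIntegrable_coord hu.2.1 i) (hψ i).continuous (hψc i)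
  · exact fun i _ => LocallyIntegrable.integrable_mul_of_hasCompactSupport hu.1
      (continuous_fderiv_apply_const (hψ i) _) (hasCompactSupport_fderiv_apply (hψc i) _)

end WeakGradient

/-- Hölder's inequality for the integral of the norm over a set of finite measure. -/
theorem setIntegral_norm_le_eLpNorm_mul {X F : Type*} [MeasurableSpace X] {μ : Measure X}
    [NormedAddCommGroup F] {p : ℝ} (hp : 1 ≤ p) {g : X → F} (hg : MemLp g (ENNReal.ofReal p) μ)
    {s : Set X} (hs : μ s ≠ ⊤) :
    ∫ x in s, ‖g x‖ ∂μ ≤ (eLpNorm g (ENNReal.ofReal p) μ).toReal * μ.real s ^ (1 - 1 / p) := by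
  have h1 : (1 : ℝ≥0∞) ≤ ENNReal.ofReal p := by simpa using hp
  have h2 := eLpNorm_le_eLpNorm_mul_rpow_measure_univ h1 hg.1.restrict (μ := μ.restrict s)
  rw [Measure.restrict_apply_univ, ENNReal.toReal_ofReal (by linarith), ENNReal.toReal_one,
    div_one] at h2
  have h3 := h2.trans (mul_le_mul_left (eLpNorm_mono_measure g Measure.restrict_le_self) _)
  have hexp : 0 ≤ 1 - 1 / p := by
    rw [sub_nonneg, div_le_one (by linarith)]
    exact hp
  have hfin : eLpNorm g (ENNReal.ofReal p) μ * μ s ^ (1 - 1 / p) ≠ ⊤ :=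
    ENNReal.mul_ne_top hg.2.ne (ENNReal.rpow_ne_top_of_nonneg hexp hs)
  have h4 := ENNReal.toReal_mono hfin h3
  rw [ENNReal.toReal_mul, ← ENNReal.toReal_rpow] at h4
  rw [integral_norm_eq_lintegral_enorm hg.1.restrict, ← eLpNorm_one_eq_lintegral_enorm]
  exact h4

/-! ### Morrey's inequality by differentiating averages in the radius -/

section Morrey

variable {n : ℕ} {u : EuclideanSpace ℝ (Fin n) → ℝ}
  {g : EuclideanSpace ℝ (Fin n) → EuclideanSpace ℝ (Fin n)}
  {η : EuclideanSpace ℝ (Fin n) → ℝ}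

/-- The rescaling `r⁻ⁿ η((w - x) / r)` of `η`, concentrated at `x`. -/
def rescale (η : EuclideanSpace ℝ (Fin n) → ℝ) (x : EuclideanSpace ℝ (Fin n)) (r : ℝ)
    (w : EuclideanSpace ℝ (Fin n)) : ℝ :=
  (r ^ n)⁻¹ * η (r⁻¹ • (w - x))

theorem contDiff_rescale (hη : ContDiff ℝ ∞ η) (x : EuclideanSpace ℝ (Fin n)) (r : ℝ) :
    ContDiff ℝ ∞ (rescale η x r) := by
  unfold rescale
  exact contDiff_const.mul (hη.comp (by fun_prop))

theorem rescale_eq_zero {R r : ℝ} (hr : 0 < r) (hR : ∀ z, R < ‖z‖ → η z = 0)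
    {x w : EuclideanSpace ℝ (Fin n)} (hw : r * R < ‖w - x‖) : rescale η x r w = 0 := by
  unfold rescale
  rw [hR, mul_zero]
  rw [norm_smul, norm_inv, Real.norm_of_nonneg hr.le, ← div_eq_inv_mul, lt_div_iff₀ hr]
  linarith

theorem hasCompactSupport_rescale {R r : ℝ} (hr : 0 < r) (hR : ∀ z, R < ‖z‖ → η z = 0)
    (x : EuclideanSpace ℝ (Fin n)) : HasCompactSupport (rescale η x r) := by
  refine HasCompactSupport.intro (isCompact_closedBall x (r * R)) fun w hw => ?_
  refine rescale_eq_zero hr hR ?_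
  rw [mem_closedBall, not_le, dist_eq_norm] at hw
  exact hw

theorem fderiv_rescale (hη : ContDiff ℝ ∞ η) (x w y : EuclideanSpace ℝ (Fin n)) (r : ℝ) :
    fderiv ℝ (rescale η x r) w y = (r ^ n)⁻¹ * fderiv ℝ η (r⁻¹ • (w - x)) (r⁻¹ • y) := by
  have h1 : HasFDerivAt (fun w : EuclideanSpace ℝ (Fin n) => r⁻¹ • (w - x))
      (r⁻¹ • ContinuousLinearMap.id ℝ _) w :=
    ((hasFDerivAt_id w).sub_const x).const_smul r⁻¹
  have h2 := (hη.differentiable (by simp)).differentiableAt (x := r⁻¹ • (w - x)) |>.hasFDerivAt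
  have h3 : HasFDerivAt (rescale η x r) _ w := (h2.comp w h1).const_mul (r ^ n)⁻¹
  rw [h3.fderiv]
  simp

/-- The radius derivative of `rescale` is minus the divergence of `r⁻¹ (w - x) rescale`. -/
theorem hasDerivAt_rescale (hη : ContDiff ℝ ∞ η) (x w : EuclideanSpace ℝ (Fin n)) {r : ℝ}
    (hr : r ≠ 0) :
    HasDerivAt (fun r => rescale η x r w)
      (-r⁻¹ * (n * rescale η x r w + fderiv ℝ (rescale η x r) w (w - x))) r := by
  have h1 : HasDerivAt (fun r : ℝ => (r ^ n)⁻¹) (-(n * r ^ (n - 1)) / (r ^ n) ^ 2) r :=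
    (hasDerivAt_pow n r).inv (pow_ne_zero n hr)
  have h2 : HasDerivAt (fun r : ℝ => r⁻¹ • (w - x)) (-(r ^ 2)⁻¹ • (w - x)) r :=
    (hasDerivAt_inv hr).smul_const (w - x)
  have h3 := (hη.differentiable (by simp)).differentiableAt (x := r⁻¹ • (w - x)) |>.hasFDerivAt
  have h4 : HasDerivAt (fun r => rescale η x r w) _ r := h1.mul (h3.comp_hasDerivAt r h2)
  convert h4 using 1
  rw [fderiv_rescale hη]
  simp only [map_smul, smul_eq_mul, rescale]
  -- The derivative of r^n contains the truncated exponent `n - 1`, so n = 0 is separate.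
  rcases n with _ | n
  · simp
    field_simp
  · simp only [Nat.add_sub_cancel]
    field_simp
    ring

/-- Differentiation under the integral sign: for radii in [r/2, 2r] all supports lie in one compact
ball, where the radial derivative is bounded. The absolute value `|R|` appears because no sign of
`R` is assumed. -/
theorem hasDerivAt_integral_rescale (hu : Continuous u) (hη : ContDiff ℝ ∞ η) {R : ℝ}
    (hR : ∀ z, R < ‖z‖ → η z = 0) (x : EuclideanSpace ℝ (Fin n)) {r : ℝ} (hr : 0 < r) :
    HasDerivAt (fun r => ∫ w, u w * rescale η x r w)
      (∫ w, u w * (-r⁻¹ * (n * rescale η x r w + fderiv ℝ (rescale η x r) w (w - x)))) r := by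
  let D : ℝ → EuclideanSpace ℝ (Fin n) → ℝ := fun s w =>
    -s⁻¹ * (n * rescale η x s w + fderiv ℝ (rescale η x s) w (w - x))
  let K := closedBall x (2 * r * |R|)
  have hK : IsCompact K := isCompact_closedBall _ _
  have hDc : ContinuousOn (fun z : ℝ × EuclideanSpace ℝ (Fin n) => D z.1 z.2)
      (Set.Icc (r / 2) (2 * r) ×ˢ K) := by
    have hinv : ContinuousOn (fun z : ℝ × EuclideanSpace ℝ (Fin n) => z.1⁻¹)
        (Set.Icc (r / 2) (2 * r) ×ˢ K) :=
      continuousOn_fst.inv₀ fun z hz => by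
        have := hz.1.1
        exact (by linarith : (0 : ℝ) < z.1).ne'
    have hpow : ContinuousOn (fun z : ℝ × EuclideanSpace ℝ (Fin n) => (z.1 ^ n)⁻¹)
        (Set.Icc (r / 2) (2 * r) ×ˢ K) := by
      exact (hinv.pow n).congr fun z _ => by simp
    have harg : ContinuousOn (fun z : ℝ × EuclideanSpace ℝ (Fin n) => z.1⁻¹ • (z.2 - x))
        (Set.Icc (r / 2) (2 * r) ×ˢ K) :=
      hinv.smul (continuousOn_snd.sub continuousOn_const)
    simp only [D, fderiv_rescale hη, rescale]
    refine hinv.neg.mul (((continuousOn_const.mul (hpow.mul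
      (hη.continuous.comp_continuousOn harg)))).add (hpow.mul ?_))
    exact ((hη.continuous_fderiv (by simp)).comp_continuousOn harg).clm_apply harg
  obtain ⟨M, hM⟩ := (isCompact_Icc.prod hK).exists_bound_of_continuousOn hDc
  have hout : ∀ s ∈ Set.Icc (r / 2) (2 * r), ∀ w, w ∉ K → D s w = 0 := by
    intro s hs w hw
    have hs0 : 0 < s := by linarith [hs.1]
    have hw' : w ∉ tsupport (rescale η x s) := by
      intro hmem
      refine hw (closure_minimal (fun w' hw' => ?_) isClosed_closedBall hmem)
      by_contra hc
      refine hw' (rescale_eq_zero hs0 hR ?_)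
      simp only [mem_closedBall, not_le, dist_eq_norm] at hc
      refine lt_of_le_of_lt ?_ hc
      exact (mul_le_mul_of_nonneg_left (le_abs_self R) hs0.le).trans
        (mul_le_mul_of_nonneg_right hs.2 (abs_nonneg R))
    simp only [D]
    rw [image_eq_zero_of_notMem_tsupport hw', fderiv_of_notMem_tsupport ℝ hw']
    simp
  have hcontD : ∀ s, Continuous fun w => D s w := fun s => by
    simp only [D]
    exact continuous_const.mul ((continuous_const.mul (contDiff_rescale hη x s).continuous).add
      (((contDiff_rescale hη x s).continuous_fderiv (by simp)).clm_apply
        (continuous_id.sub continuous_const)))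
  refine (hasDerivAt_integral_of_dominated_loc_of_deriv_le
    (F := fun s w => u w * rescale η x s w) (F' := fun s w => u w * D s w)
    (s := Set.Icc (r / 2) (2 * r)) (bound := K.indicator fun w => |u w| * M)
    (Icc_mem_nhds (by linarith) (by linarith)) ?_ ?_ ?_ ?_ ?_ ?_).2
  · exact Eventually.of_forall fun s =>
      (hu.mul (contDiff_rescale hη x s).continuous).aestronglyMeasurable
  · exact LocallyIntegrable.integrable_mul_of_hasCompactSupport hu.locallyIntegrable
      (contDiff_rescale hη x r).continuous (hasCompactSupport_rescale hr hR x)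
  · exact (hu.mul (hcontD r)).aestronglyMeasurable
  · refine Eventually.of_forall fun w s hs => ?_
    by_cases hw : w ∈ K
    · rw [Set.indicator_of_mem hw, norm_mul]
      exact mul_le_mul_of_nonneg_left (hM (s, w) ⟨hs, hw⟩) (abs_nonneg _)
    · rw [Set.indicator_of_notMem hw, hout s hs w hw]
      simp
  · rw [integrable_indicator_iff hK.measurableSet]
    exact ((hu.abs.mul continuous_const).continuousOn).integrableOn_compact hK
  · refine Eventually.of_forall fun w s hs => ?_
    have hs0 : 0 < s := by linarith [hs.1]
    exact (hasDerivAt_rescale hη x w hs0.ne').const_mul (u w)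

/-- Integration by parts replaces the derivative by r⁻¹ ∫ ⟨g, w - x⟩ η_r. Here |w - x| ≤ rR and
|η_r| ≤ M r⁻ⁿ, and Hölder on the ball adds r^(n(1 - 1/p)). The resulting power r^(-n/p) is
integrable at 0 when p > n. -/
theorem HasWeakGradient.abs_deriv_integral_rescale_le (hu : HasWeakGradient u g) {p : ℝ}
    (hp : 1 ≤ p) (hg : MemLp g (ENNReal.ofReal p) volume) (hη : ContDiff ℝ ∞ η) {R M : ℝ}
    (hR0 : 0 ≤ R) (hM : ∀ z, |η z| ≤ M) (hR : ∀ z, R < ‖z‖ → η z = 0)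
    (x : EuclideanSpace ℝ (Fin n)) {r : ℝ} (hr : 0 < r) :
    |∫ w, u w * (-r⁻¹ * (n * rescale η x r w + fderiv ℝ (rescale η x r) w (w - x)))| ≤
      R * M * (volume.real (closedBall (0 : EuclideanSpace ℝ (Fin n)) R)) ^ (1 - 1 / p) *
        (eLpNorm g (ENNReal.ofReal p) volume).toReal * r ^ (-(n / p)) := by
  have hp0 : 0 < p := by linarith
  have hM0 : 0 ≤ M := (abs_nonneg _).trans (hM 0)
  have hc := hasCompactSupport_rescale hr hR x
  have hs := contDiff_rescale hη x r
  have h1 : ∫ w, u w * (-r⁻¹ * (n * rescale η x r w + fderiv ℝ (rescale η x r) w (w - x))) =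
      r⁻¹ * ∫ w, inner ℝ (g w) (w - x) * rescale η x r w := by
    have : ∀ w, u w * (-r⁻¹ * (n * rescale η x r w + fderiv ℝ (rescale η x r) w (w - x))) =
        -r⁻¹ * (u w * (n * rescale η x r w + fderiv ℝ (rescale η x r) w (w - x))) :=
      fun w => by ring
    simp only [this]
    rw [integral_const_mul, hu.integral_mul_div_radial hs hc x]
    ring
  rw [h1, abs_mul, abs_of_pos (inv_pos.2 hr)]
  set B := closedBall x (r * R) with hB
  have hgB : IntegrableOn (fun w => ‖g w‖) B := (hu.2.1.integrableOn_isCompact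
    (isCompact_closedBall x (r * R))).norm
  have h2 : |∫ w, inner ℝ (g w) (w - x) * rescale η x r w| ≤
      ∫ w in B, ‖g w‖ * (r * R * ((r ^ n)⁻¹ * M)) := by
    rw [← integral_indicator measurableSet_closedBall]
    refine norm_integral_le_of_norm_le (f := fun w => inner ℝ (g w) (w - x) * rescale η x r w)
      ((integrable_indicator_iff measurableSet_closedBall).2 (hgB.mul_const _))
      (Eventually.of_forall fun w => ?_)
    by_cases hw : w ∈ B
    · rw [Set.indicator_of_mem hw, norm_mul, mul_comm (r * R), ← mul_assoc, mul_right_comm]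
      have h3 : ‖w - x‖ ≤ r * R := by rwa [hB, mem_closedBall, dist_eq_norm] at hw
      have h4 : ‖inner ℝ (g w) (w - x)‖ ≤ ‖g w‖ * (r * R) :=
        (norm_inner_le_norm _ _).trans (mul_le_mul_of_nonneg_left h3 (norm_nonneg _))
      have h5 : ‖rescale η x r w‖ ≤ (r ^ n)⁻¹ * M := by
        rw [rescale, norm_mul, Real.norm_of_nonneg (by positivity)]
        exact mul_le_mul_of_nonneg_left (hM _) (by positivity)
      exact mul_le_mul h4 h5 (norm_nonneg _) (by positivity)
    · rw [Set.indicator_of_notMem hw, rescale_eq_zero hr hR]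
      · simp
      · rwa [hB, mem_closedBall, dist_eq_norm, not_le] at hw
  rw [integral_mul_const] at h2
  have h3 := setIntegral_norm_le_eLpNorm_mul hp hg (s := B) (isCompact_closedBall _ _).measure_ne_top
  have h4 : volume.real B ^ (1 - 1 / p) = r ^ (n * (1 - 1 / p)) *
      volume.real (closedBall (0 : EuclideanSpace ℝ (Fin n)) R) ^ (1 - 1 / p) := by
    rw [hB, Measure.addHaar_real_closedBall volume x (by positivity),
      Measure.addHaar_real_closedBall volume 0 hR0, mul_pow, mul_assoc, Real.mul_rpow
        (by positivity) (by positivity), Real.rpow_mul hr.le]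
    simp
  rw [h4] at h3
  have h5 : r ^ (-(n / p)) = (r ^ n)⁻¹ * r ^ (n * (1 - 1 / p)) := by
    rw [← Real.rpow_natCast, ← Real.rpow_neg hr.le, ← Real.rpow_add hr]
    congr 1
    field_simp
    ring
  calc _ ≤ r⁻¹ * ((∫ w in B, ‖g w‖) * (r * R * ((r ^ n)⁻¹ * M))) := by gcongr
    _ ≤ r⁻¹ * (((eLpNorm g (ENNReal.ofReal p) volume).toReal * (r ^ (n * (1 - 1 / p)) *
      volume.real (closedBall (0 : EuclideanSpace ℝ (Fin n)) R) ^ (1 - 1 / p))) *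
        (r * R * ((r ^ n)⁻¹ * M))) := by gcongr
    _ = _ := by
      rw [h5]
      field_simp

/-- The substitution w = x + rz gives an integral over a fixed ball that is continuous in r, also at
r = 0. -/
theorem tendsto_integral_rescale (hu : Continuous u) (hη : Continuous η) {R : ℝ}
    (hR : ∀ z, R < ‖z‖ → η z = 0) (h1 : ∫ z, η z = 1) (x : EuclideanSpace ℝ (Fin n)) :
    Tendsto (fun r => ∫ w, u w * rescale η x r w) (𝓝[>] 0) (𝓝 (u x)) := by
  have hR' : ∀ z, z ∉ closedBall (0 : EuclideanSpace ℝ (Fin n)) R → η z = 0 := fun z hz =>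
    hR z (by simpa using hz)
  have heq : ∀ r : ℝ, 0 < r → ∫ w, u w * rescale η x r w =
      ∫ z in closedBall (0 : EuclideanSpace ℝ (Fin n)) R, u (x + r • z) * η z := fun r hr => by
    rw [setIntegral_eq_integral_of_forall_compl_eq_zero fun z hz => by rw [hR' z hz, mul_zero]]
    have h2 := Measure.integral_comp_inv_smul (volume : Measure (EuclideanSpace ℝ (Fin n)))
      (fun z => u (x + r • z) * η z) r
    rw [finrank_euclideanSpace_fin, abs_of_pos (pow_pos hr n)] at h2
    have h3 := integral_sub_right_eq_self (μ := (volume : Measure (EuclideanSpace ℝ (Fin n))))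
      (fun w => u (x + r • r⁻¹ • w) * η (r⁻¹ • w)) x
    rw [h2] at h3
    have h4 : ∀ w, u w * rescale η x r w =
        (r ^ n)⁻¹ * (u (x + r • r⁻¹ • (w - x)) * η (r⁻¹ • (w - x))) := fun w => by
      rw [smul_smul, mul_inv_cancel₀ hr.ne', one_smul, add_sub_cancel, rescale]
      ring
    simp only [h4]
    rw [integral_const_mul, h3, smul_eq_mul, ← mul_assoc, inv_mul_cancel₀ (by positivity), one_mul]
  have hcont : Continuous fun r : ℝ =>
      ∫ z in closedBall (0 : EuclideanSpace ℝ (Fin n)) R, u (x + r • z) * η z := by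
    refine continuous_parametric_integral_of_continuous ?_ (isCompact_closedBall _ _)
    simp only [Function.uncurry_def]
    fun_prop
  have h0 : ∫ z in closedBall (0 : EuclideanSpace ℝ (Fin n)) R, u (x + (0 : ℝ) • z) * η z =
      u x := by
    simp only [zero_smul, add_zero]
    rw [integral_const_mul, setIntegral_eq_integral_of_forall_compl_eq_zero hR', h1, mul_one]
  rw [← h0]
  refine ((hcont.tendsto 0).mono_left nhdsWithin_le_nhds).congr' ?_
  filter_upwards [self_mem_nhdsWithin] with r hr
  exact (heq r hr).symm

/-- **Morrey's inequality**: the value of `u` at `x` differs from an average of `u` around `x` by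
at most a constant times the `L^p` norm of the weak gradient. -/
theorem HasWeakGradient.abs_sub_integral_le (hu : HasWeakGradient u g) (huc : Continuous u)
    {p : ℝ} (hp : 1 ≤ p) (hnp : (n : ℝ) < p) (hg : MemLp g (ENNReal.ofReal p) volume)
    (hη : ContDiff ℝ ∞ η) {R M : ℝ} (hR0 : 0 ≤ R) (hM : ∀ z, |η z| ≤ M)
    (hR : ∀ z, R < ‖z‖ → η z = 0) (h1 : ∫ z, η z = 1) (x : EuclideanSpace ℝ (Fin n)) :
    |u x - ∫ w, u w * η (w - x)| ≤
      R * M * (volume.real (closedBall (0 : EuclideanSpace ℝ (Fin n)) R)) ^ (1 - 1 / p) /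
        (1 - n / p) * (eLpNorm g (ENNReal.ofReal p) volume).toReal := by
  have hp0 : 0 < p := by linarith
  have hM0 : 0 ≤ M := (abs_nonneg _).trans (hM 0)
  have hα : 0 < 1 - n / p := by rw [sub_pos, div_lt_one hp0]; exact hnp
  set C := R * M * (volume.real (closedBall (0 : EuclideanSpace ℝ (Fin n)) R)) ^ (1 - 1 / p)
  set N := (eLpNorm g (ENNReal.ofReal p) volume).toReal
  have hC : 0 ≤ C := by positivity
  have hN : 0 ≤ N := ENNReal.toReal_nonneg
  -- `f r` is the average at scale r. Comparing `f` on [s, 1] with the primitive of its derivative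
  -- bound gives an estimate independent of s; then s → 0 recovers u(x).
  let f : ℝ → ℝ := fun r => ∫ w, u w * rescale η x r w
  have hf1 : f 1 = ∫ w, u w * η (w - x) := by simp [f, rescale]
  have hbound : ∀ s ∈ Set.Ioo (0 : ℝ) 1, |f s - f 1| ≤ C / (1 - n / p) * N := by
    intro s hs
    have hder : ∀ r ∈ Set.Icc s 1, HasDerivAt f
        (∫ w, u w * (-r⁻¹ * (n * rescale η x r w + fderiv ℝ (rescale η x r) w (w - x)))) r :=
      fun r hr => hasDerivAt_integral_rescale huc hη hR x (hs.1.trans_le hr.1)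
    have hBder : ∀ r ∈ Set.Icc s 1, HasDerivAt
        (fun r : ℝ => C * N / (1 - n / p) * (r ^ (1 - n / p) - s ^ (1 - n / p)))
        (C * N * r ^ (-(n / p))) r := fun r hr => by
      have h2 := ((Real.hasDerivAt_rpow_const (p := 1 - n / p)
        (Or.inl (hs.1.trans_le hr.1).ne')).sub_const (s ^ (1 - n / p))).const_mul
          (C * N / (1 - n / p))
      refine h2.congr_deriv ?_
      rw [show (1 - (n : ℝ) / p - 1) = -(n / p) by ring, ← mul_assoc, div_mul_cancel₀ _ hα.ne']
    have h3 := image_norm_le_of_norm_deriv_right_le_deriv_boundary' (f := fun r => f r - f s)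
      (a := s) (b := 1)
      (fun r hr => ((hder r hr).sub_const _).continuousAt.continuousWithinAt)
      (fun r hr => ((hder r (Set.Ico_subset_Icc_self hr)).sub_const _).hasDerivWithinAt)
      (B := fun r : ℝ => C * N / (1 - n / p) * (r ^ (1 - n / p) - s ^ (1 - n / p)))
      (by simp) (fun r hr => (hBder r hr).continuousAt.continuousWithinAt)
      (fun r hr => (hBder r (Set.Ico_subset_Icc_self hr)).hasDerivWithinAt)
      (fun r hr => hu.abs_deriv_integral_rescale_le hp hg hη hR0 hM hR x (hs.1.trans_le hr.1))
      (Set.right_mem_Icc.2 hs.2.le)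
    simp only [Real.one_rpow] at h3
    have h4 : 0 ≤ s ^ (1 - n / p) := Real.rpow_nonneg hs.1.le _
    have h5 : 0 ≤ C * N / (1 - n / p) := by positivity
    rw [abs_sub_comm]
    calc |f 1 - f s| ≤ C * N / (1 - n / p) * (1 - s ^ (1 - n / p)) := h3
      _ ≤ C * N / (1 - n / p) := by nlinarith
      _ = _ := by ring
  rw [← hf1]
  have hlim := ((tendsto_integral_rescale huc hη.continuous hR h1 x).sub_const (f 1)).abs
  refine le_of_tendsto hlim ?_
  filter_upwards [Ioo_mem_nhdsGT zero_lt_one] with s hs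
  exact hbound s hs

end Morrey

/-! ### Gradient fields form a closed subspace of `L^p` -/

section Closedness

variable {n : ℕ} {u v : EuclideanSpace ℝ (Fin n) → ℝ}
  {g h : EuclideanSpace ℝ (Fin n) → EuclideanSpace ℝ (Fin n)}

/-- A fixed smooth bump function with integral one. -/
def unitBump (n : ℕ) : EuclideanSpace ℝ (Fin n) → ℝ :=
  (⟨1, 2, one_pos, one_lt_two⟩ : ContDiffBump (0 : EuclideanSpace ℝ (Fin n))).normed volume

theorem contDiff_unitBump (n : ℕ) : ContDiff ℝ ∞ (unitBump n) :=
  ContDiffBump.contDiff_normed _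

theorem hasCompactSupport_unitBump (n : ℕ) : HasCompactSupport (unitBump n) :=
  ContDiffBump.hasCompactSupport_normed _

theorem integral_unitBump (n : ℕ) : ∫ x, unitBump n x = 1 :=
  ContDiffBump.integral_normed _

theorem unitBump_eq_zero {z : EuclideanSpace ℝ (Fin n)} (hz : 2 < ‖z‖) : unitBump n z = 0 := by
  rw [unitBump, ← Function.notMem_support, ContDiffBump.support_normed_eq]
  simpa using hz.le

/-- The average of `u` with respect to the fixed bump function. -/
def bumpAverage (u : EuclideanSpace ℝ (Fin n) → ℝ) : ℝ :=
  ∫ w, u w * unitBump n w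

theorem integrable_mul_unitBump (hu : Continuous u) : Integrable fun w => u w * unitBump n w :=
  LocallyIntegrable.integrable_mul_of_hasCompactSupport hu.locallyIntegrable
    (contDiff_unitBump n).continuous (hasCompactSupport_unitBump n)

theorem bumpAverage_sub (hu : Continuous u) (hv : Continuous v) :
    bumpAverage (u - v) = bumpAverage u - bumpAverage v := by
  simp only [bumpAverage, Pi.sub_apply, sub_mul]
  exact integral_sub (integrable_mul_unitBump hu) (integrable_mul_unitBump hv)

theorem HasWeakGradient.sub (hu : HasWeakGradient u g) (hv : HasWeakGradient v h) :
    HasWeakGradient (u - v) (g - h) := by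
  have := hu.add (hv.const_smul (-1))
  simpa [sub_eq_add_neg] using this

theorem HasWeakGradient.sub_const (hu : HasWeakGradient u g) (c : ℝ) :
    HasWeakGradient (fun x => u x - c) g := by
  have := hu.sub (hasWeakGradient_const (n := n) c)
  rwa [sub_zero] at this

/-- Morrey's inequality on a ball, relative to a fixed average. -/
theorem exists_forall_abs_sub_bumpAverage_le {p : ℝ} (hp : 1 ≤ p) (hnp : (n : ℝ) < p) (L : ℝ) :
    ∃ C : ℝ, 0 ≤ C ∧ ∀ (u : EuclideanSpace ℝ (Fin n) → ℝ)
      (g : EuclideanSpace ℝ (Fin n) → EuclideanSpace ℝ (Fin n)), Continuous u →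
      HasWeakGradient u g → MemLp g (ENNReal.ofReal p) volume → ∀ x, ‖x‖ ≤ L →
        |u x - bumpAverage u| ≤ C * (eLpNorm g (ENNReal.ofReal p) volume).toReal := by
  have hα : 0 < 1 - n / p := by rw [sub_pos, div_lt_one (by linarith)]; exact hnp
  obtain ⟨M, hM⟩ := (hasCompactSupport_unitBump n).exists_bound_of_continuous
    (contDiff_unitBump n).continuous
  have hM0 : 0 ≤ M := (norm_nonneg _).trans (hM 0)
  refine ⟨(2 + |L|) * M * (volume.real (closedBall (0 : EuclideanSpace ℝ (Fin n)) (2 + |L|))) ^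
    (1 - 1 / p) / (1 - n / p), by positivity, fun u g huc hu hg x hx => ?_⟩
  -- Translating the bump by x makes η(w - x) = `unitBump n w`, so every x is compared with the same
  -- average. The price is the larger support radius 2 + |L|.
  have h1 := hu.abs_sub_integral_le huc hp hnp hg (η := fun z => unitBump n (z + x))
    ((contDiff_unitBump n).comp (contDiff_id.add contDiff_const)) (R := 2 + |L|) (M := M)
    (by positivity) (fun z => hM _) (fun z hz => unitBump_eq_zero ?_) ?_ x
  · simp only [sub_add_cancel] at h1
    exact h1
  · have h2 := norm_sub_le (z + x) x
    rw [add_sub_cancel_right] at h2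
    linarith [le_abs_self L]
  · rw [integral_add_right_eq_self (unitBump n)]
    exact integral_unitBump n

theorem integral_mul_tendsto_of_abs_sub_le {F : ℕ → EuclideanSpace ℝ (Fin n) → ℝ}
    {f ψ : EuclideanSpace ℝ (Fin n) → ℝ} {c : ℕ → ℝ} (hF : ∀ k, LocallyIntegrable (F k))
    (hf : LocallyIntegrable f) (hψ : Continuous ψ) (hc : HasCompactSupport ψ)
    (h : ∀ k, ∫ x, |F k x - f x| * |ψ x| ≤ c k) (hc0 : Tendsto c atTop (𝓝 0)) :
    Tendsto (fun k => ∫ x, F k x * ψ x) atTop (𝓝 (∫ x, f x * ψ x)) := by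
  rw [tendsto_iff_norm_sub_tendsto_zero]
  refine squeeze_zero (fun _ => norm_nonneg _) (fun k => ?_) hc0
  rw [← integral_sub (LocallyIntegrable.integrable_mul_of_hasCompactSupport (hF k) hψ hc)
    (LocallyIntegrable.integrable_mul_of_hasCompactSupport hf hψ hc)]
  refine (norm_integral_le_integral_norm _).trans (le_of_eq_of_le ?_ (h k))
  refine integral_congr_ae (Eventually.of_forall fun x => ?_)
  simp only
  rw [← sub_mul, norm_mul, Real.norm_eq_abs, Real.norm_eq_abs]

/-- The `L^p` vector fields that are weak gradients of continuous functions. -/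
def gradientSubmodule (n : ℕ) (p : ℝ) [Fact (1 ≤ ENNReal.ofReal p)] :
    Submodule ℝ (Lp (EuclideanSpace ℝ (Fin n)) (ENNReal.ofReal p)
      (volume : Measure (EuclideanSpace ℝ (Fin n)))) where
  carrier := {G | ∃ u, Continuous u ∧ HasWeakGradient u G}
  add_mem' := by
    rintro G H ⟨u, huc, hu⟩ ⟨v, hvc, hv⟩
    exact ⟨u + v, huc.add hvc, (hu.add hv).congr_ae (Lp.coeFn_add G H).symm⟩
  zero_mem' := ⟨fun _ => 0, continuous_const,
    (hasWeakGradient_const 0).congr_ae (Lp.coeFn_zero _ _ _).symm⟩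
  smul_mem' := by
    rintro c G ⟨u, huc, hu⟩
    exact ⟨c • u, huc.const_smul c, (hu.const_smul c).congr_ae (Lp.coeFn_smul c G).symm⟩

/-- Convergence of gradients in `L^p` forces, by Morrey, locally uniform convergence of suitably
normalized potentials; their continuous limit is a potential of the limit field. -/
theorem isClosed_gradientSubmodule {p : ℝ} (hp : 1 ≤ p) (hnp : (n : ℝ) < p)
    [Fact (1 ≤ ENNReal.ofReal p)] :
    IsClosed (gradientSubmodule n p : Set (Lp (EuclideanSpace ℝ (Fin n)) (ENNReal.ofReal p)
      (volume : Measure (EuclideanSpace ℝ (Fin n))))) := by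
  refine IsSeqClosed.isClosed fun G G₀ hG hlim => ?_
  choose u huc hu using hG
  choose C hC0 hC using fun L : ℝ => exists_forall_abs_sub_bumpAverage_le (n := n) hp hnp L
  -- Potentials are only determined up to constants, so the averages are normalized to zero.
  let v : ℕ → EuclideanSpace ℝ (Fin n) → ℝ := fun k x => u k x - bumpAverage (u k)
  have hvc : ∀ k, Continuous (v k) := fun k => (huc k).sub continuous_const
  have hv : ∀ k, HasWeakGradient (v k) (G k) := fun k => (hu k).sub_const _
  have hdiff : ∀ L x, ‖x‖ ≤ L → ∀ k m, |v k x - v m x| ≤ C L * ‖G k - G m‖ := by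
    intro L x hx k m
    have h1 := hC L (u k - u m) (G k - G m : Lp _ _ _) ((huc k).sub (huc m))
      (((hu k).sub (hu m)).congr_ae (Lp.coeFn_sub _ _).symm) (Lp.memLp _) x hx
    rw [bumpAverage_sub (huc k) (huc m), ← Lp.norm_def] at h1
    convert h1 using 2
    simp only [v, Pi.sub_apply]
    ring
  have hcau : ∀ x, CauchySeq fun k => v k x := by
    intro x
    have hG := hlim.cauchySeq
    rw [Metric.cauchySeq_iff] at hG ⊢
    intro ε hε
    obtain ⟨N, hN⟩ := hG (ε / (C ‖x‖ + 1)) (div_pos hε (by linarith [hC0 ‖x‖]))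
    refine ⟨N, fun k hk m hm => ?_⟩
    have h1 := hN k hk m hm
    rw [dist_eq_norm, lt_div_iff₀ (by linarith [hC0 ‖x‖])] at h1
    have h2 := hdiff ‖x‖ x le_rfl k m
    rw [Real.dist_eq]
    nlinarith [norm_nonneg (G k - G m)]
  choose w hw using fun x => cauchySeq_tendsto_of_complete (hcau x)
  have hunif : ∀ L x, ‖x‖ ≤ L → ∀ k, |v k x - w x| ≤ C L * ‖G k - G₀‖ := by
    intro L x hx k
    exact le_of_tendsto_of_tendsto' ((tendsto_const_nhds.sub (hw x)).abs)
      ((tendsto_const_nhds.sub hlim).norm.const_mul (C L)) (fun m => hdiff L x hx k m)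
  have hlim0 : Tendsto (fun k => ‖G k - G₀‖) atTop (𝓝 0) := by
    rw [← tendsto_iff_norm_sub_tendsto_zero]
    exact hlim
  have hwc : Continuous w := by
    have hloc : TendstoLocallyUniformly v w atTop := by
      rw [Metric.tendstoLocallyUniformly_iff]
      intro ε hε x
      refine ⟨ball x 1, ball_mem_nhds x one_pos, ?_⟩
      have h1 : Tendsto (fun k => C (‖x‖ + 1) * ‖G k - G₀‖) atTop (𝓝 0) := by
        simpa using hlim0.const_mul (C (‖x‖ + 1))
      filter_upwards [h1.eventually_lt_const hε] with k hk y hy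
      rw [dist_comm, Real.dist_eq]
      refine (hunif (‖x‖ + 1) y ?_ k).trans_lt hk
      rw [mem_ball, dist_eq_norm] at hy
      linarith [norm_sub_norm_le y x]
    exact hloc.continuous (Frequently.of_forall hvc)
  have hG₀ : LocallyIntegrable (G₀ : EuclideanSpace ℝ (Fin n) → EuclideanSpace ℝ (Fin n)) :=
    (Lp.memLp G₀).locallyIntegrable Fact.out
  refine ⟨w, hwc, hwc.locallyIntegrable, hG₀, fun φ hφ hc i => ?_⟩
  have hψ := continuous_fderiv_apply_const hφ (EuclideanSpace.single i (1 : ℝ))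
  have hψc := hasCompactSupport_fderiv_apply hc (EuclideanSpace.single i (1 : ℝ))
  have hl : Tendsto (fun k => ∫ x, v k x * fderiv ℝ φ x (EuclideanSpace.single i 1)) atTop
      (𝓝 (∫ x, w x * fderiv ℝ φ x (EuclideanSpace.single i 1))) := by
    obtain ⟨L, hL⟩ := hψc.isBounded.subset_closedBall (0 : EuclideanSpace ℝ (Fin n))
    refine integral_mul_tendsto_of_abs_sub_le (fun k => (hvc k).locallyIntegrable)
      hwc.locallyIntegrable hψ hψc
      (c := fun k => C L * ‖G k - G₀‖ *
        ∫ x, |fderiv ℝ φ x (EuclideanSpace.single i 1)|) (fun k => ?_) ?_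
    · rw [← integral_const_mul]
      have hi := (hψ.integrable_of_hasCompactSupport hψc (μ := volume)).abs
      refine integral_mono_of_nonneg (Eventually.of_forall fun x => by positivity)
        (hi.const_mul _) (Eventually.of_forall fun x => ?_)
      by_cases hx : x ∈ tsupport fun x => fderiv ℝ φ x (EuclideanSpace.single i (1 : ℝ))
      · exact mul_le_mul_of_nonneg_right (hunif L x (by simpa using hL hx) k) (abs_nonneg _)
      · have h0 := image_eq_zero_of_notMem_tsupport hx
        simp [h0]
    · simpa using (hlim0.const_mul (C L)).mul_const
        (∫ x, |fderiv ℝ φ x (EuclideanSpace.single i 1)|)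
  -- Hölder on the support of φ turns `L^p` convergence into convergence of the tested components.
  have hr : Tendsto (fun k => ∫ x, G k x i * φ x) atTop (𝓝 (∫ x, G₀ x i * φ x)) := by
    obtain ⟨M, hM⟩ := hc.exists_bound_of_continuous hφ.continuous
    refine integral_mul_tendsto_of_abs_sub_le (fun k => locallyIntegrable_coord (hv k).2.1 i)
      (locallyIntegrable_coord hG₀ i) hφ.continuous hc
      (c := fun k => ‖G k - G₀‖ * volume.real (tsupport φ) ^ (1 - 1 / p) * M) (fun k => ?_) ?_
    · have hmem : MemLp (fun x => G k x - G₀ x) (ENNReal.ofReal p) volume :=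
        (Lp.memLp (G k)).sub (Lp.memLp G₀)
      have h1 := setIntegral_norm_le_eLpNorm_mul hp hmem (s := tsupport φ) hc.measure_ne_top
      have h2 : (eLpNorm (fun x => G k x - G₀ x) (ENNReal.ofReal p) volume).toReal =
          ‖G k - G₀‖ := by
        rw [Lp.norm_def]
        congr 1
        exact (eLpNorm_congr_ae (Lp.coeFn_sub _ _)).symm
      rw [h2] at h1
      have hM0 : 0 ≤ M := (norm_nonneg _).trans (hM 0)
      have hint : IntegrableOn (fun x => ‖G k x - G₀ x‖) (tsupport φ) :=
        (((hv k).2.1.sub hG₀).integrableOn_isCompact hc).norm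
      refine le_trans ?_ (mul_le_mul_of_nonneg_right h1 hM0)
      rw [← integral_mul_const, ← integral_indicator (isClosed_tsupport φ).measurableSet]
      refine integral_mono_of_nonneg (Eventually.of_forall fun x => by positivity)
        ((integrable_indicator_iff (isClosed_tsupport φ).measurableSet).2 (hint.mul_const M))
        (Eventually.of_forall fun x => ?_)
      by_cases hx : x ∈ tsupport φ
      · rw [Set.indicator_of_mem hx]
        refine mul_le_mul ?_ (hM x) (abs_nonneg _) (norm_nonneg _)
        exact PiLp.norm_apply_le (G k x - G₀ x) i
      · rw [Set.indicator_of_notMem hx]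
        simp [image_eq_zero_of_notMem_tsupport hx]
    · simpa using (hlim0.mul_const (volume.real (tsupport φ) ^ (1 - 1 / p))).mul_const M
  exact tendsto_nhds_unique hl (by simpa only [(hv _).2.2 φ hφ hc i] using hr.neg)

end Closedness

/-! ### Behaviour under similarities -/

section Similarity

variable {n : ℕ} {u : EuclideanSpace ℝ (Fin n) → ℝ}
  {g : EuclideanSpace ℝ (Fin n) → EuclideanSpace ℝ (Fin n)}

theorem HasWeakGradient.gradNorm_eq (hu : HasWeakGradient u g) (p : ℝ) :
    gradNorm p u = eLpNorm g (ENNReal.ofReal p) volume := by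
  have hex : ∃ g, HasWeakGradient u g := ⟨g, hu⟩
  rw [gradNorm, weakGradient, dif_pos hex]
  exact eLpNorm_congr_ae (hex.choose_spec.ae_eq hu)

/-- The similarity `y ↦ r O y + z` as a homeomorphism. -/
def similarityHomeomorph {r : ℝ} (hr : 0 < r)
    (O : EuclideanSpace ℝ (Fin n) ≃ₗᵢ[ℝ] EuclideanSpace ℝ (Fin n))
    (z : EuclideanSpace ℝ (Fin n)) : EuclideanSpace ℝ (Fin n) ≃ₜ EuclideanSpace ℝ (Fin n) :=
  (O.toHomeomorph.trans (Homeomorph.smulOfNeZero r hr.ne')).trans (Homeomorph.addRight z)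

variable {r : ℝ} (hr : 0 < r) (O : EuclideanSpace ℝ (Fin n) ≃ₗᵢ[ℝ] EuclideanSpace ℝ (Fin n))
  (z : EuclideanSpace ℝ (Fin n))

theorem similarityHomeomorph_apply (y : EuclideanSpace ℝ (Fin n)) :
    similarityHomeomorph hr O z y = r • O y + z := rfl

theorem similarityHomeomorph_symm_apply (w : EuclideanSpace ℝ (Fin n)) :
    (similarityHomeomorph hr O z).symm w = O.symm (r⁻¹ • (w - z)) := by
  rw [Homeomorph.symm_apply_eq, similarityHomeomorph_apply]
  simp [smul_smul, mul_inv_cancel₀ hr.ne']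

theorem map_similarityHomeomorph_volume :
    (volume : Measure (EuclideanSpace ℝ (Fin n))).map (similarityHomeomorph hr O z) =
      ENNReal.ofReal ((r ^ n)⁻¹) • volume := by
  have h1 : (similarityHomeomorph hr O z : EuclideanSpace ℝ (Fin n) → EuclideanSpace ℝ (Fin n)) =
      (fun y => y + z) ∘ (fun y => r • y) ∘ O := rfl
  rw [h1, ← Measure.map_map (by fun_prop) (by fun_prop),
    ← Measure.map_map (by fun_prop) (by fun_prop), O.measurePreserving.map_eq,
    Measure.map_addHaar_smul _ hr.ne', Measure.map_smul, map_add_right_eq_self,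
    finrank_euclideanSpace_fin, abs_of_pos (by positivity)]

theorem integral_comp_similarityHomeomorph (F : EuclideanSpace ℝ (Fin n) → ℝ) :
    ∫ y, F (similarityHomeomorph hr O z y) = (r ^ n)⁻¹ * ∫ w, F w := by
  rw [← (similarityHomeomorph hr O z).measurableEmbedding.integral_map,
    map_similarityHomeomorph_volume, integral_smul_measure, ENNReal.toReal_ofReal (by positivity),
    smul_eq_mul]

/-- The chain rule contributes r and the change of variables r^(-n/p); the isometry does not affect
norms. -/
theorem eLpNorm_comp_similarityHomeomorph {p : ℝ} (hp : 0 < p)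
    (g : EuclideanSpace ℝ (Fin n) → EuclideanSpace ℝ (Fin n)) :
    eLpNorm (fun y => r • O.symm (g (similarityHomeomorph hr O z y))) (ENNReal.ofReal p) volume =
      ENNReal.ofReal (r ^ (1 - n / p)) * eLpNorm g (ENNReal.ofReal p) volume := by
  have h1 : eLpNorm (fun y => r • O.symm (g (similarityHomeomorph hr O z y)))
      (ENNReal.ofReal p) volume =
      eLpNorm (r • (g ∘ similarityHomeomorph hr O z)) (ENNReal.ofReal p) volume :=
    eLpNorm_congr_norm_ae (Eventually.of_forall fun y => by simp [norm_smul])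
  rw [h1, eLpNorm_const_smul,
    ← (similarityHomeomorph hr O z).measurableEmbedding.eLpNorm_map_measure,
    map_similarityHomeomorph_volume, eLpNorm_smul_measure_of_ne_top ENNReal.ofReal_ne_top,
    ENNReal.toReal_div, ENNReal.toReal_one, ENNReal.toReal_ofReal hp.le, Real.enorm_of_nonneg hr.le, smul_eq_mul, ← mul_assoc,
    ENNReal.ofReal_rpow_of_nonneg (by positivity) (by positivity), ← ENNReal.ofReal_mul hr.le]
  congr 2
  rw [← Real.rpow_natCast, ← Real.rpow_neg hr.le, ← Real.rpow_mul hr.le]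
  nth_rewrite 1 [← Real.rpow_one r]
  rw [← Real.rpow_add hr]
  congr 1
  field_simp
  ring

/-- The chain rule for weak gradients under similarities. -/
theorem HasWeakGradient.comp_similarityHomeomorph (hu : HasWeakGradient u g)
    (huc : Continuous u) {p : ℝ} (hp : 1 ≤ p) (hg : MemLp g (ENNReal.ofReal p) volume) :
    HasWeakGradient (fun y => u (similarityHomeomorph hr O z y))
      (fun y => r • O.symm (g (similarityHomeomorph hr O z y))) ∧
    MemLp (fun y => r • O.symm (g (similarityHomeomorph hr O z y))) (ENNReal.ofReal p) volume := by
  set S := similarityHomeomorph hr O z with hS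
  have hp0 : 0 < p := by linarith
  have hmem : MemLp (fun y => r • O.symm (g (S y))) (ENNReal.ofReal p) volume := by
    refine ⟨?_, ?_⟩
    · have h1 : AEStronglyMeasurable g (volume.map S) := by
        rw [hS, map_similarityHomeomorph_volume]
        exact hg.1.smul_measure _
      exact (O.symm.continuous.comp_aestronglyMeasurable
        (h1.comp_measurable S.continuous.measurable)).const_smul r
    · rw [hS, eLpNorm_comp_similarityHomeomorph hr O z hp0]
      exact ENNReal.mul_lt_top ENNReal.ofReal_lt_top hg.2
  refine ⟨⟨(huc.comp S.continuous).locallyIntegrable,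
    hmem.locallyIntegrable (by simpa using hp), fun φ hφ hc i => ?_⟩, hmem⟩
  -- Transporting the test function by S turns its i-th partial derivative into the derivative of ψ
  -- along rOe_i, whence the need for the weak identity in arbitrary directions.
  let ψ : EuclideanSpace ℝ (Fin n) → ℝ := φ ∘ S.symm
  have hψeq : ψ = fun w => φ (O.symm (r⁻¹ • (w - z))) := by
    ext w
    simp only [ψ, Function.comp, hS, similarityHomeomorph_symm_apply]
  have hψ : ContDiff ℝ ∞ ψ := by
    rw [hψeq]
    exact hφ.comp (O.symm.contDiff.comp (by fun_prop))
  have hψc : HasCompactSupport ψ := hc.comp_homeomorph S.symm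
  have hφψ : ∀ y, φ y = ψ (S y) := fun y => by simp [ψ]
  have hSd : ∀ y, HasFDerivAt S (r • (O.toContinuousLinearEquiv : _ →L[ℝ] _)) y := fun y =>
    ((O.toContinuousLinearEquiv.hasFDerivAt (x := y)).const_smul r).add_const z
  have hd : ∀ y, fderiv ℝ φ y (EuclideanSpace.single i 1) =
      fderiv ℝ ψ (S y) (r • O (EuclideanSpace.single i 1)) := fun y => by
    have h1 := ((hψ.differentiable (by simp)).differentiableAt (x := S y)).hasFDerivAt.comp y
      (hSd y)
    have h2 : ψ ∘ S = φ := by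
      ext y
      exact (hφψ y).symm
    rw [h2] at h1
    rw [h1.fderiv]
    simp
  have hcoord : ∀ y, (r • O.symm (g (S y))) i =
      inner ℝ (g (S y)) (r • O (EuclideanSpace.single i 1)) := fun y => by
    rw [inner_smul_right, real_inner_comm, LinearIsometryEquiv.inner_map_eq_flip,
      EuclideanSpace.inner_single_left]
    simp
  simp only [hd, hcoord]
  simp only [hφψ]
  rw [integral_comp_similarityHomeomorph hr O z
      (fun w => u w * fderiv ℝ ψ w (r • O (EuclideanSpace.single i 1))),
    integral_comp_similarityHomeomorph hr O z
      (fun w => inner ℝ (g w) (r • O (EuclideanSpace.single i 1)) * ψ w),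
    hu.integral_mul_fderiv hψ hψc]
  ring

end Similarity

/-! ### The linear functional defined by `ρ` and its maximizer -/

section Charge

variable {n : ℕ} {ρ : SignedMeasure (EuclideanSpace ℝ (Fin n))}

theorem isFiniteMeasure_variation (ρ : SignedMeasure (EuclideanSpace ℝ (Fin n))) :
    IsFiniteMeasure ρ.variation := by
  rw [← SignedMeasure.totalVariation_eq_variation]
  unfold SignedMeasure.totalVariation
  infer_instance

theorem exists_ae_norm_le (hsupp : IsCompact (signedSupport ρ)) :
    ∃ L : ℝ, ∀ᵐ x ∂ρ.variation, ‖x‖ ≤ L := by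
  obtain ⟨L, hL⟩ := hsupp.isBounded.subset_closedBall (0 : EuclideanSpace ℝ (Fin n))
  refine ⟨L, ?_⟩
  have h1 : ∀ᵐ x ∂ρ.totalVariation, x ∈ ρ.totalVariation.support := Measure.support_mem_ae
  rw [SignedMeasure.totalVariation_eq_variation] at h1
  rw [signedSupport, SignedMeasure.totalVariation_eq_variation] at hL
  filter_upwards [h1] with x hx
  simpa using hL hx

theorem integrable_variation_of_continuous {F : Type*} [NormedAddCommGroup F]
    [SecondCountableTopology F] (hsupp : IsCompact (signedSupport ρ))
    {f : EuclideanSpace ℝ (Fin n) → F} (hf : Continuous f) : ρ.Integrable f := by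
  have := isFiniteMeasure_variation ρ
  obtain ⟨L, hL⟩ := exists_ae_norm_le hsupp
  obtain ⟨M, hM⟩ := (isCompact_closedBall (0 : EuclideanSpace ℝ (Fin n)) L).exists_bound_of_continuousOn
    hf.continuousOn
  refine Integrable.of_bound hf.aestronglyMeasurable M ?_
  filter_upwards [hL] with x hx
  exact hM x (by simpa using hx)

theorem integral_const_eq_zero_of_univ (hzero : ρ Set.univ = 0) (c : ℝ) :
    ∫ᵛ _, c ∂•ρ = 0 := by
  have := isFiniteMeasure_variation ρ
  rw [VectorMeasure.integral_const, hzero, map_zero]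

/-- Pairing with a neutral compactly supported charge is controlled by the weak gradient. -/
theorem exists_forall_abs_integral_le {p : ℝ} (hp : 1 ≤ p) (hnp : (n : ℝ) < p)
    (hsupp : IsCompact (signedSupport ρ)) (hzero : ρ Set.univ = 0) :
    ∃ C : ℝ, ∀ (u : EuclideanSpace ℝ (Fin n) → ℝ)
      (g : EuclideanSpace ℝ (Fin n) → EuclideanSpace ℝ (Fin n)), Continuous u →
      HasWeakGradient u g → MemLp g (ENNReal.ofReal p) volume →
        |∫ᵛ x, u x ∂•ρ| ≤ C * (eLpNorm g (ENNReal.ofReal p) volume).toReal := by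
  have := isFiniteMeasure_variation ρ
  obtain ⟨L, hL⟩ := exists_ae_norm_le hsupp
  obtain ⟨C, hC0, hC⟩ := exists_forall_abs_sub_bumpAverage_le (n := n) hp hnp L
  refine ⟨C * ‖ContinuousLinearMap.lsmul ℝ ℝ (E := ℝ)‖ * ρ.variation.real Set.univ,
    fun u g huc hu hg => ?_⟩
  -- Neutrality of `ρ` allows the average of u to be subtracted at no cost, after which Morrey's
  -- bound applies on the support.
  have h1 := VectorMeasure.norm_integral_le_of_norm_le_const (μ := ρ)
    (B := ContinuousLinearMap.lsmul ℝ ℝ) (f := fun x => u x - bumpAverage u)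
    (C := C * (eLpNorm g (ENNReal.ofReal p) volume).toReal)
    (by filter_upwards [hL] with x hx using hC u g huc hu hg x hx)
  rw [VectorMeasure.integral_fun_sub (integrable_variation_of_continuous hsupp huc)
    (integrable_variation_of_continuous hsupp continuous_const),
    integral_const_eq_zero_of_univ hzero, sub_zero] at h1
  calc _ ≤ _ := h1
    _ = _ := by ring

/-- The sharp constant for the pairing of gradient fields with a neutral compactly supported charge
is attained. -/
theorem exists_extremal_integral {p : ℝ} (hp : 1 < p) (hnp : (n : ℝ) < p)
    (hsupp : IsCompact (signedSupport ρ)) (hzero : ρ Set.univ = 0) :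
    ∃ K : ℝ≥0, (∀ u g, Continuous u → HasWeakGradient u g →
        MemLp g (ENNReal.ofReal p) volume →
        |∫ᵛ x, u x ∂•ρ| ≤ K * (eLpNorm g (ENNReal.ofReal p) volume).toReal) ∧
      ∃ u g, Continuous u ∧ HasWeakGradient u g ∧ MemLp g (ENNReal.ofReal p) volume ∧
        eLpNorm g (ENNReal.ofReal p) volume ≤ 1 ∧ ∫ᵛ x, u x ∂•ρ = K := by
  have hfact : Fact (1 ≤ ENNReal.ofReal p) := ⟨by simpa using hp.le⟩
  obtain ⟨C, hC⟩ := exists_forall_abs_integral_le hp.le hnp hsupp hzero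
  let W := gradientSubmodule n p
  have hWc : CompleteSpace W := (isClosed_gradientSubmodule hp.le hnp).completeSpace_coe
  have := uniformConvexSpace_Lp (F := EuclideanSpace ℝ (Fin n))
    (μ := (volume : Measure (EuclideanSpace ℝ (Fin n)))) hp
  have := uniformConvexSpace_submodule W
  choose pot hpotc hpot using fun G : W => G.2
  -- The choice `pot` need not be linear. Two potentials of one field differ by a function with zero
  -- gradient, which the bound `hC` makes pair to zero, so the functional is well defined and
  -- linear.
  have huniq : ∀ (G : W) u, Continuous u → HasWeakGradient u G.1 →
      ∫ᵛ x, u x ∂•ρ = ∫ᵛ x, pot G x ∂•ρ := by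
    intro G u huc hu
    have h1 := hC (u - pot G) (G.1 - G.1) (huc.sub (hpotc G)) (hu.sub (hpot G)) (by simp)
    rw [sub_self, eLpNorm_zero, ENNReal.toReal_zero, mul_zero] at h1
    have h2 := abs_nonpos_iff.1 h1
    rw [VectorMeasure.integral_sub (integrable_variation_of_continuous hsupp huc)
      (integrable_variation_of_continuous hsupp (hpotc G))] at h2
    linarith
  let ℓ₀ : W →ₗ[ℝ] ℝ :=
    { toFun := fun G => ∫ᵛ x, pot G x ∂•ρ
      map_add' := fun G H => by
        rw [← huniq (G + H) (pot G + pot H) ((hpotc G).add (hpotc H))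
          (((hpot G).add (hpot H)).congr_ae (Lp.coeFn_add G.1 H.1).symm)]
        exact VectorMeasure.integral_add (integrable_variation_of_continuous hsupp (hpotc G))
          (integrable_variation_of_continuous hsupp (hpotc H))
      map_smul' := fun c G => by
        rw [← huniq (c • G) (c • pot G) ((hpotc G).const_smul c)
          (((hpot G).const_smul c).congr_ae (Lp.coeFn_smul c G.1).symm)]
        exact VectorMeasure.integral_smul _ _ _ c }
  let ℓ : W →L[ℝ] ℝ := ℓ₀.mkContinuous C fun G =>
    hC (pot G) G.1 (hpotc G) (hpot G) (Lp.memLp G.1)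
  obtain ⟨G, hG1, hG⟩ := exists_norm_le_one_apply_eq_norm ℓ
  refine ⟨‖ℓ‖₊, fun u g huc hu hg => ?_, pot G, G.1, hpotc G, hpot G, Lp.memLp G.1, ?_, hG⟩
  · have hw : HasWeakGradient u (hg.toLp g) := hu.congr_ae hg.coeFn_toLp.symm
    have h1 := ℓ.le_opNorm ⟨hg.toLp g, u, huc, hw⟩
    have h2 := huniq ⟨hg.toLp g, u, huc, hw⟩ u huc hw
    rw [h2]
    have h3 : ‖(⟨hg.toLp g, u, huc, hw⟩ : W)‖ =
        (eLpNorm g (ENNReal.ofReal p) volume).toReal := Lp.norm_toLp g hg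
    rw [h3] at h1
    exact h1
  · have h1 : ‖G.1‖ ≤ 1 := hG1
    rw [Lp.norm_def] at h1
    rw [← ENNReal.ofReal_toReal (Lp.memLp G.1).2.ne]
    simpa using h1

end Charge

/-! ### From the functional to the generalized Morrey seminorm -/

section Extremal

variable {n : ℕ} {ρ : SignedMeasure (EuclideanSpace ℝ (Fin n))}

theorem apply_integral_eq_integral_apply {F : Type*} [NormedAddCommGroup F] [NormedSpace ℝ F]
    [CompleteSpace F] (hsupp : IsCompact (signedSupport ρ))
    (A : EuclideanSpace ℝ (Fin n) →L[ℝ] F) :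
    A (∫ᵛ y, y ∂<•ρ) = ∫ᵛ y, A y ∂<•ρ := by
  have hid : ρ.Integrable (fun y : EuclideanSpace ℝ (Fin n) => y) :=
    integrable_variation_of_continuous hsupp continuous_id
  rw [VectorMeasure.continuousLinearMap_apply_integral hid,
    VectorMeasure.integral_continuousLinearMap_comp hid]
  congr 1
  ext x
  simp

/-- The translation contributes z times the total mass, which vanishes. -/
theorem integral_map_similarityHomeomorph {r : ℝ} (hr : 0 < r)
    (O : EuclideanSpace ℝ (Fin n) ≃ₗᵢ[ℝ] EuclideanSpace ℝ (Fin n))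
    (z : EuclideanSpace ℝ (Fin n)) (hsupp : IsCompact (signedSupport ρ))
    (hzero : ρ Set.univ = 0) :
    ∫ᵛ x, x ∂<•(ρ.map (similarityHomeomorph hr O z)) = r • O (∫ᵛ y, y ∂<•ρ) := by
  have := isFiniteMeasure_variation ρ
  rw [(similarityHomeomorph hr O z).measurableEmbedding.integral_map_vectorMeasure]
  have h1 := apply_integral_eq_integral_apply hsupp
    (r • (O.toContinuousLinearEquiv : EuclideanSpace ℝ (Fin n) →L[ℝ] EuclideanSpace ℝ (Fin n)))
  have h2 : r • O (∫ᵛ y, y ∂<•ρ) = ∫ᵛ y, r • O y ∂<•ρ := h1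
  rw [h2]
  simp only [similarityHomeomorph_apply]
  rw [VectorMeasure.integral_fun_add (f := fun y => r • O y)
    (integrable_variation_of_continuous hsupp (O.continuous.const_smul r))
    (integrable_variation_of_continuous hsupp continuous_const),
    VectorMeasure.integral_const, hzero, map_zero, add_zero]

theorem morreyQuotient_map_similarityHomeomorph {r : ℝ} (hr : 0 < r)
    (O : EuclideanSpace ℝ (Fin n) ≃ₗᵢ[ℝ] EuclideanSpace ℝ (Fin n))
    (z : EuclideanSpace ℝ (Fin n)) (hsupp : IsCompact (signedSupport ρ))
    (hzero : ρ Set.univ = 0) (p : ℝ) (u : EuclideanSpace ℝ (Fin n) → ℝ) :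
    morreyQuotient p (ρ.map (similarityHomeomorph hr O z)) u =
      |∫ᵛ y, u (similarityHomeomorph hr O z y) ∂•ρ| /
        (r ^ (1 - n / p) * ‖∫ᵛ y, y ∂<•ρ‖ ^ (1 - n / p)) := by
  rw [morreyQuotient, integral_map_similarityHomeomorph hr O z hsupp hzero,
    (similarityHomeomorph hr O z).measurableEmbedding.integral_map_vectorMeasure, norm_smul,
    LinearIsometryEquiv.norm_map, Real.norm_of_nonneg hr.le,
    Real.mul_rpow hr.le (norm_nonneg _)]

theorem ofReal_morreyQuotient_le_rhoSeminorm (p : ℝ) (ρ : SignedMeasure (EuclideanSpace ℝ (Fin n)))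
    (u : EuclideanSpace ℝ (Fin n) → ℝ) :
    ENNReal.ofReal (morreyQuotient p ρ u) ≤ rhoSeminorm p ρ u := by
  have hid : (id : EuclideanSpace ℝ (Fin n) → EuclideanSpace ℝ (Fin n)) ∈ similarities n :=
    ⟨1, LinearIsometryEquiv.refl ℝ _, 0, one_pos, by ext1 y; simp⟩
  have h1 := le_iSup₂ (f := fun S (_ : S ∈ similarities n) =>
    ENNReal.ofReal (morreyQuotient p (ρ.map S) u)) id hid
  rwa [VectorMeasure.map_id] at h1

/-- A bound for the pairing with `ρ` yields the generalized Morrey inequality. -/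
theorem rhoSeminorm_le_of_abs_integral_le {p : ℝ} (hp : 1 ≤ p)
    (hsupp : IsCompact (signedSupport ρ)) (hzero : ρ Set.univ = 0)
    (hmoment : ∫ᵛ y, y ∂<•ρ ≠ 0) {K : ℝ≥0}
    (hK : ∀ u g, Continuous u → HasWeakGradient u g → MemLp g (ENNReal.ofReal p) volume →
        |∫ᵛ x, u x ∂•ρ| ≤ K * (eLpNorm g (ENNReal.ofReal p) volume).toReal)
    {u : EuclideanSpace ℝ (Fin n) → ℝ} (hu : u ∈ D1p n p) :
    rhoSeminorm p ρ u ≤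
      ENNReal.ofReal (K / ‖∫ᵛ y, y ∂<•ρ‖ ^ (1 - n / p)) * gradNorm p u := by
  obtain ⟨huc, g, hug, hg⟩ := hu
  have hD : 0 < ‖∫ᵛ y, y ∂<•ρ‖ ^ (1 - n / p) := Real.rpow_pos_of_pos (norm_pos_iff.2 hmoment) _
  rw [hug.gradNorm_eq]
  refine iSup₂_le fun S hS => ?_
  obtain ⟨r, O, z, hr, rfl⟩ := hS
  change ENNReal.ofReal (morreyQuotient p (ρ.map (similarityHomeomorph hr O z)) u) ≤ _
  rw [morreyQuotient_map_similarityHomeomorph hr O z hsupp hzero]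
  -- Testing the bound on u ∘ S produces the factor r^(1 - n/p) that cancels the one in the
  -- denominator.
  obtain ⟨h1, h2⟩ := hug.comp_similarityHomeomorph hr O z huc hp hg
  have h3 := hK _ _ (huc.comp (similarityHomeomorph hr O z).continuous) h1 h2
  have hrp : 0 < r ^ (1 - n / p) := Real.rpow_pos_of_pos hr _
  rw [eLpNorm_comp_similarityHomeomorph hr O z (by linarith), ENNReal.toReal_mul,
    ENNReal.toReal_ofReal hrp.le] at h3
  rw [← ENNReal.ofReal_toReal hg.2.ne, ← ENNReal.ofReal_mul (by positivity)]
  refine ENNReal.ofReal_le_ofReal ?_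
  rw [div_le_iff₀ (by positivity)]
  refine h3.trans (le_of_eq ?_)
  field_simp

/-- A compactly supported smooth function pairing positively with a charge of nonzero moment. -/
theorem exists_hasWeakGradient_integral_pos (p : ℝ) (hsupp : IsCompact (signedSupport ρ))
    (hmoment : ∫ᵛ y, y ∂<•ρ ≠ 0) :
    ∃ u g, Continuous u ∧ HasWeakGradient u g ∧ MemLp g (ENNReal.ofReal p) volume ∧
      0 < ∫ᵛ x, u x ∂•ρ := by
  set m := ∫ᵛ y, y ∂<•ρ with hm
  obtain ⟨L, hL⟩ := exists_ae_norm_le hsupp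
  -- The cut-off equals 1 on a ball carrying `ρ`, so it does not change the pairing; adding 1 to |L|
  -- keeps the radius positive.
  let χ : ContDiffBump (0 : EuclideanSpace ℝ (Fin n)) :=
    ⟨|L| + 1, |L| + 2, by positivity, by linarith⟩
  let u : EuclideanSpace ℝ (Fin n) → ℝ := fun x => inner ℝ m x * χ x
  have hu : ContDiff ℝ 1 u := (contDiff_const.inner ℝ contDiff_id).mul χ.contDiff
  have hc : HasCompactSupport u := χ.hasCompactSupport.mul_left
  have hgc : Continuous (gradient u) :=
    (InnerProductSpace.toDual ℝ _).symm.continuous.comp (hu.continuous_fderiv (by simp))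
  have hgs : HasCompactSupport (gradient u) :=
    (hc.fderiv (𝕜 := ℝ)).comp_left (g := (InnerProductSpace.toDual ℝ _).symm) (map_zero _)
  refine ⟨u, gradient u, hu.continuous, hasWeakGradient_gradient hu,
    hgc.memLp_of_hasCompactSupport hgs, ?_⟩
  have h1 : ∫ᵛ x, u x ∂•ρ = ∫ᵛ x, innerSL ℝ m x ∂•ρ := by
    refine VectorMeasure.integral_congr_ae ?_
    filter_upwards [hL] with x hx
    have h2 : χ x = 1 := χ.one_of_mem_closedBall (by
      rw [mem_closedBall_zero_iff]
      change ‖x‖ ≤ |L| + 1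
      linarith [le_abs_self L])
    simp [u, h2]
  -- For real integrands the pairings behind `∂•` and `∂<•` agree by commutativity.
  have h3 : (ContinuousLinearMap.lsmul ℝ ℝ : ℝ →L[ℝ] ℝ →L[ℝ] ℝ) =
      (ContinuousLinearMap.lsmul ℝ ℝ).flip := by
    ext
    simp
  rw [h1, h3, ← apply_integral_eq_integral_apply hsupp (innerSL ℝ m), ← hm]
  simpa using pow_pos (norm_pos_iff.2 hmoment) 2

end Extremal

end GeneralizedMorrey
end

theorem mainTheorem3 (n : ℕ) (p : ℝ) (hp : (n : ℝ) < p)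
    (ρ : SignedMeasure (EuclideanSpace ℝ (Fin n)))
    (hsupp : IsCompact (GeneralizedMorrey.signedSupport ρ))
    (hzero : ρ Set.univ = 0)
    (hmoment : ∫ᵛ y, y ∂<•ρ ≠ 0) :
    ∃ Cstar : ℝ≥0, IsLeast {C : ℝ≥0 | GeneralizedMorrey.IsMorreyConstant p ρ C} Cstar ∧
      ∃ u ∈ GeneralizedMorrey.D1p n p, (¬ ∃ c : ℝ, ∀ x, u x = c) ∧
        GeneralizedMorrey.rhoSeminorm p ρ u = Cstar * GeneralizedMorrey.gradNorm p u := by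
  open GeneralizedMorrey in
  -- In dimension zero every moment vanishes. Together with n < p this gives p > 1, needed for
  -- uniform convexity.
  have hn : 1 ≤ n := by
    by_contra! h
    obtain rfl : n = 0 := by omega
    exact hmoment (Subsingleton.elim _ _)
  have hp1 : 1 < p := lt_of_le_of_lt (by exact_mod_cast hn) hp
  obtain ⟨K, hK, u, g, huc, hu, hg, hg1, huK⟩ := exists_extremal_integral hp1 hp hsupp hzero
  have hKpos : 0 < (K : ℝ) := by
    obtain ⟨v, h, hvc, hv, hh, hpos⟩ := exists_hasWeakGradient_integral_pos p hsupp hmoment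
    by_contra! hle
    have h1 := hK v h hvc hv hh
    have h2 : (K : ℝ) * (eLpNorm h (ENNReal.ofReal p) volume).toReal ≤ 0 :=
      mul_nonpos_of_nonpos_of_nonneg hle ENNReal.toReal_nonneg
    linarith [le_abs_self (∫ᵛ x, v x ∂•ρ)]
  have huD : u ∈ D1p n p := ⟨huc, g, hu, hg⟩
  set D := ‖∫ᵛ y, y ∂<•ρ‖ ^ (1 - n / p) with hD
  have hupper : ∀ v ∈ D1p n p, rhoSeminorm p ρ v ≤ ENNReal.ofReal (K / D) * gradNorm p v :=
    fun v hv => rhoSeminorm_le_of_abs_integral_le hp1.le hsupp hzero hmoment hK hv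
  have hgrad : gradNorm p u ≤ 1 := (hu.gradNorm_eq p).trans_le hg1
  have hlower : ENNReal.ofReal (K / D) ≤ rhoSeminorm p ρ u := by
    have h1 := ofReal_morreyQuotient_le_rhoSeminorm p ρ u
    rwa [morreyQuotient, huK, abs_of_pos hKpos] at h1
  -- For any admissible C, K/D ≤ [u]_ρ ≤ C ‖Du‖_p ≤ C, so K/D is least. With C = K/D the chain
  -- closes up to equality, and ‖Du‖_p = 1 is never needed.
  refine ⟨(K / D).toNNReal, ⟨hupper, fun C hC => ?_⟩, u, huD, ?_, ?_⟩
  · have h1 := hlower.trans ((hC u huD).trans (mul_le_of_le_one_right' hgrad))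
    exact ENNReal.coe_le_coe.1 h1
  · rintro ⟨c, hc⟩
    have h1 : u = fun _ => c := funext hc
    rw [h1, integral_const_eq_zero_of_univ hzero] at huK
    exact hKpos.ne huK
  · exact le_antisymm (hupper u huD) ((mul_le_of_le_one_right' hgrad).trans hlower)
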